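/- Let $\Gamma=(G,E)$ be a connected, countably infinite, locally finite graph without loops or multiple edges. Let $\pi_{xy}=\pi_{yx}\ge 0$ be edge weights with $\pi_{xy}>0$ if and only if $\{x,y\}\in E$, put $\pi_x=\sum_y\pi_{xy}$, and let $(\theta_x)_{x\in G}$ be positive vertex weights such that $\sum_{x\in U}\theta_x=\infty$ for every infinite connected $U\subset G$. Let $\mathcal L_\theta$ be the operator on the real Hilbert space $L^2(\theta)$ given by $$(\mathcal L_\theta f)(x)=\frac1{\theta_x}\sum_{y\sim x}\pi_{xy}(f(y)-f(x)),\qquad \mathcal D(\mathcal L_\theta)=\{f\in L^2(\theta):\mathcal L_\theta f\in L^2(\theta)\},$$ and let $\lambda_0^{ess}(\Gamma,\pi,\theta)\in[0,\infty]$ be the infimum of the essential spectrum of $-\mathcal L_\theta$, that is, of the set of points of its spectrum which are accumulation points of the spectrum or eigenvalues of infinite multiplicity (with $\inf\varnothing=\infty$). A metric $\rho$ on $G$ is adapted to $\mathcal L_\theta$ if $\frac1{\theta_x}\sum_{y\sim x}\pi_{xy}\rho(x,y)^2\le 1$ for all $x\in G$ and $\rho$ is bounded on the set of edges. Put $$\mu=VG(\Gamma,\pi,\theta,\rho)=\limsup_{r\to\infty}\frac1r\log\sum_{x:\,\rho(x_0,x)\le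 r}\theta_x\in[0,\infty],$$ which does not depend on $x_0\in G$. **Theorem.** (a) Let $\rho$ be a metric adapted to $\mathcal L_\theta$, and suppose that there are constants $m,M>0$ with $m\le\rho(x,y)\le M$ whenever $x\sim y$. Then $$\lambda_0^{ess}(\Gamma,\pi,\theta)\le\frac1{m^2}\,\frac{(1-e^{M\mu/2})^2}{1+e^{M\mu}},$$ where the right-hand side is read as its limit $\frac1{m^2}$ if $\mu=\infty$. (b) (Fujiwara's bound.) For the standard weights ($\pi_{xy}=1$ on every edge), the vertex weights $\theta=\pi$ and the graph metric $d$ satisfy the hypotheses of (a) with $m=M=1$, and if $\mu=VG(\Gamma,\pi,\pi,d)<\infty$, then $$\lambda_0^{ess}(\Gamma,\pi,\pi)\le 1-\frac{2e^{\mu/2}}{1+e^{\mu}}.$$ (c) If $\Gamma$ is an (infinite) $k$-regular tree with the standard weights, then $\mu<\infty$ and equality holds in (a) for $\theta=\pi$ with $\rho=d$ and $m=M=1$, and also for $\theta\equiv 1$ with the metric $\rho=\frac1{\sqrt k}d$, which is adapted to $\mathcal L_\theta$, and $m=M=\frac1{\sqrt k}$. -/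

import Mathlib

open MeasureTheory Filter Topology
open scoped ENNReal

/-! ### Weighted graphs -/

/-- Edge weights on a simple graph: nonnegative, symmetric, and positive exactly on the edges. -/
structure EdgeWeights {G : Type*} (Γ : SimpleGraph G) where
  weight : G → G → ℝ
  nonneg : ∀ x y, 0 ≤ weight x y
  symm : ∀ x y, weight x y = weight y x
  pos_iff : ∀ x y, 0 < weight x y ↔ Γ.Adj x y

namespace EdgeWeights

open Classical in
/-- The standard weights: every edge has weight one. -/
noncomputable def standard {G : Type*} (Γ : SimpleGraph G) : EdgeWeights Γ where
  weight x y := if Γ.Adj x y then 1 else 0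
  nonneg x y := by split_ifs <;> norm_num
  symm x y := by simp only [Γ.adj_comm]
  pos_iff x y := by split_ifs with h <;> simp [h]

/-- The vertex weight `π_x`, the sum of the weights of the edges at `x`. -/
noncomputable def vertexWeight {G : Type*} {Γ : SimpleGraph G} [Γ.LocallyFinite]
    (w : EdgeWeights Γ) (x : G) : ℝ :=
  ∑ y ∈ Γ.neighborFinset x, w.weight x y

theorem vertexWeight_pos {G : Type*} [Nontrivial G] {Γ : SimpleGraph G} [Γ.LocallyFinite]
    (w : EdgeWeights Γ) (hΓ : Γ.Connected) (x : G) : 0 < w.vertexWeight x := by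
  obtain ⟨y, hy⟩ := hΓ.preconnected.exists_adj_of_nontrivial x
  refine Finset.sum_pos' (fun y _ => w.nonneg x y) ⟨y, ?_, (w.pos_iff x y).2 hy⟩
  simpa using hy

end EdgeWeights

/-- The measure on the vertex set which gives the vertex `x` the mass `θ x`. -/
noncomputable def vertexMeasure {G : Type*} [MeasurableSpace G] (θ : G → ℝ) : Measure G :=
  Measure.sum fun x => ENNReal.ofReal (θ x) • Measure.dirac x

/-- Every infinite connected set of vertices has infinite `θ`-mass. -/
def InfiniteMassOnInfiniteConnected {G : Type*} [MeasurableSpace G] (Γ : SimpleGraph G)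
    (θ : G → ℝ) : Prop :=
  ∀ U : Set G, U.Infinite → (Γ.induce U).Connected → vertexMeasure θ U = ⊤

/-! ### The Laplacian on `L²(θ)` -/

/-- The pointwise Laplacian `(𝓛_θ f)(x) = θ_x⁻¹ ∑_{y ∼ x} π_{xy} (f y - f x)`. -/
noncomputable def laplacianFun {G : Type*} {Γ : SimpleGraph G} [Γ.LocallyFinite]
    (w : EdgeWeights Γ) (θ : G → ℝ) (f : G → ℝ) (x : G) : ℝ :=
  1 / θ x * ∑ y ∈ Γ.neighborFinset x, w.weight x y * (f y - f x)

theorem laplacianFun_add {G : Type*} {Γ : SimpleGraph G} [Γ.LocallyFinite]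
    (w : EdgeWeights Γ) (θ : G → ℝ) (f g : G → ℝ) :
    laplacianFun w θ (f + g) = laplacianFun w θ f + laplacianFun w θ g := by
  ext x
  simp only [laplacianFun, Pi.add_apply, ← mul_add, ← Finset.sum_add_distrib]
  congr 1
  exact Finset.sum_congr rfl fun y _ => by ring

theorem laplacianFun_smul {G : Type*} {Γ : SimpleGraph G} [Γ.LocallyFinite]
    (w : EdgeWeights Γ) (θ : G → ℝ) (c : ℝ) (f : G → ℝ) :
    laplacianFun w θ (c • f) = c • laplacianFun w θ f := by
  ext x
  simp only [laplacianFun, Pi.smul_apply, smul_eq_mul, Finset.mul_sum]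
  exact Finset.sum_congr rfl fun y _ => by ring

/-- If all the masses are positive, functions that agree almost everywhere are equal. -/
theorem eq_of_ae_eq_vertexMeasure {G : Type*} [MeasurableSpace G] [DiscreteMeasurableSpace G]
    {θ : G → ℝ} (hθ : ∀ x, 0 < θ x) {f g : G → ℝ} (h : f =ᵐ[vertexMeasure θ] g) : f = g := by
  ext x
  by_contra hne
  have h0 : vertexMeasure θ {y | ¬ f y = g y} = 0 := h
  rw [vertexMeasure, Measure.sum_apply _ (MeasurableSet.of_discrete), ENNReal.tsum_eq_zero] at h0
  have hx := h0 x
  rw [Measure.smul_apply, Measure.dirac_apply' _ (MeasurableSet.of_discrete),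
    Set.indicator_of_mem (by exact hne)] at hx
  simp at hx
  exact absurd (hθ x) (not_lt.2 hx)

/-- The operator `𝓛_θ` on `L²(θ)`, with domain `{f ∈ L²(θ) : 𝓛_θ f ∈ L²(θ)}`. -/
noncomputable def laplacian {G : Type*} [MeasurableSpace G] [DiscreteMeasurableSpace G]
    {Γ : SimpleGraph G} [Γ.LocallyFinite] (w : EdgeWeights Γ) (θ : G → ℝ)
    (hθ : ∀ x, 0 < θ x) :
    Lp ℝ 2 (vertexMeasure θ) →ₗ.[ℝ] Lp ℝ 2 (vertexMeasure θ) where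
  domain :=
    { carrier := {f | MemLp (laplacianFun w θ f) 2 (vertexMeasure θ)}
      add_mem' := fun {f g} hf hg => by
        change MemLp (laplacianFun w θ ⇑(f + g)) 2 _
        rw [eq_of_ae_eq_vertexMeasure hθ (Lp.coeFn_add f g), laplacianFun_add]
        exact MemLp.add hf hg
      zero_mem' := by
        change MemLp (laplacianFun w θ ⇑(0 : Lp ℝ 2 (vertexMeasure θ))) 2 _
        rw [eq_of_ae_eq_vertexMeasure hθ (Lp.coeFn_zero ℝ 2 (vertexMeasure θ))]
        have : laplacianFun w θ 0 = 0 := by ext x; simp [laplacianFun]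
        rw [this]
        exact MemLp.zero
      smul_mem' := fun c f hf => by
        change MemLp (laplacianFun w θ ⇑(c • f)) 2 _
        rw [eq_of_ae_eq_vertexMeasure hθ (Lp.coeFn_smul c f), laplacianFun_smul]
        exact MemLp.const_smul hf c }
  toFun :=
    { toFun := fun f => MemLp.toLp (laplacianFun w θ f.1) f.2
      map_add' := fun f g => by
        rw [← MemLp.toLp_add]
        congr 1
        rw [← laplacianFun_add, ← eq_of_ae_eq_vertexMeasure hθ (Lp.coeFn_add f.1 g.1)]
        rfl
      map_smul' := fun c f => by
        rw [RingHom.id_apply, ← MemLp.toLp_const_smul]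
        congr 1
        rw [← laplacianFun_smul, ← eq_of_ae_eq_vertexMeasure hθ (Lp.coeFn_smul c f.1)]
        rfl }

/-! ### Spectrum and essential spectrum of an unbounded operator -/

/-- The resolvent set: `T - z`, as a map from the domain of `T` to the whole space, has a
bounded everywhere defined two-sided inverse `R`. -/
def pmapResolventSet {H : Type*} [NormedAddCommGroup H] [NormedSpace ℝ H]
    (T : H →ₗ.[ℝ] H) : Set ℝ :=
  {z | ∃ R : H →L[ℝ] H,
    (∀ u : H, ∃ h : R u ∈ T.domain, T ⟨R u, h⟩ - z • R u = u) ∧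
    ∀ f : T.domain, R (T f - z • (f : H)) = f}

def pmapSpectrum {H : Type*} [NormedAddCommGroup H] [NormedSpace ℝ H]
    (T : H →ₗ.[ℝ] H) : Set ℝ :=
  (pmapResolventSet T)ᶜ

/-- The eigenspace `ker (T - z)`, as a subspace of the domain of `T`. -/
def pmapEigenspace {H : Type*} [NormedAddCommGroup H] [NormedSpace ℝ H]
    (T : H →ₗ.[ℝ] H) (z : ℝ) : Submodule ℝ T.domain :=
  LinearMap.ker (T.toFun - z • T.domain.subtype)

/-- The essential spectrum: the points of the spectrum which are accumulation points of the
spectrum or eigenvalues of infinite multiplicity. -/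
def pmapEssSpectrum {H : Type*} [NormedAddCommGroup H] [NormedSpace ℝ H]
    (T : H →ₗ.[ℝ] H) : Set ℝ :=
  {z | z ∈ pmapSpectrum T ∧
    (AccPt z (𝓟 (pmapSpectrum T)) ∨ ¬ FiniteDimensional ℝ (pmapEigenspace T z))}

/-- The bottom `λ₀^ess` of the essential spectrum of `-𝓛_θ`, an extended real number
(it is `⊤` if the essential spectrum is empty). -/
noncomputable def lambdaEss {G : Type*} [MeasurableSpace G] [DiscreteMeasurableSpace G]
    {Γ : SimpleGraph G} [Γ.LocallyFinite] (w : EdgeWeights Γ) (θ : G → ℝ)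
    (hθ : ∀ x, 0 < θ x) : EReal :=
  sInf ((fun z : ℝ => (z : EReal)) '' pmapEssSpectrum (-laplacian w θ hθ))

/-! ### Adapted metrics and volume growth -/

/-- `ρ` is a metric on `G`. -/
structure IsMetric {G : Type*} (ρ : G → G → ℝ) : Prop where
  eq_zero_iff : ∀ x y, ρ x y = 0 ↔ x = y
  symm : ∀ x y, ρ x y = ρ y x
  triangle : ∀ x y z, ρ x z ≤ ρ x y + ρ y z

/-- `ρ` is a metric adapted to `𝓛_θ`. -/
structure IsAdaptedMetric {G : Type*} {Γ : SimpleGraph G} [Γ.LocallyFinite]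
    (w : EdgeWeights Γ) (θ : G → ℝ) (ρ : G → G → ℝ) : Prop where
  isMetric : IsMetric ρ
  sum_le_one : ∀ x, 1 / θ x * ∑ y ∈ Γ.neighborFinset x, w.weight x y * ρ x y ^ 2 ≤ 1
  bounded : ∃ c : ℝ, 0 < c ∧ ∀ x y, Γ.Adj x y → ρ x y ≤ c

/-- The `θ`-volume of the closed `ρ`-ball of radius `r` around `x₀`. -/
noncomputable def ballVolume {G : Type*} [MeasurableSpace G] (θ : G → ℝ) (ρ : G → G → ℝ)
    (x₀ : G) (r : ℝ) : ℝ≥0∞ :=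
  vertexMeasure θ {x | ρ x₀ x ≤ r}

/-- The exponential volume growth `limsup_{r → ∞} r⁻¹ log V_ρ(x₀, r)`, with values in the
extended reals. -/
noncomputable def volumeGrowth {G : Type*} [MeasurableSpace G] (θ : G → ℝ) (ρ : G → G → ℝ)
    (x₀ : G) : EReal :=
  limsup (fun r : ℝ => ((1 / r : ℝ) : EReal) * ENNReal.log (ballVolume θ ρ x₀ r)) atTop

/-- The number `m⁻² (1 - e^{Mμ/2})² / (1 + e^{Mμ})`. -/
noncomputable def growthBound (m M μ : ℝ) : ℝ :=
  1 / m ^ 2 * ((1 - Real.exp (1 / 2 * M * μ)) ^ 2 / (1 + Real.exp (M * μ)))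

/-- The graph metric, with real values. -/
noncomputable def graphMetric {G : Type*} (Γ : SimpleGraph G) (x y : G) : ℝ :=
  (Γ.dist x y : ℝ)

/-!
The lower bound `m` on the edge lengths of an adapted metric gives `π_x ≤ m⁻² θ_x`, so that
`A = -𝓛_θ` is an everywhere defined symmetric operator on `L²(θ)`, hence bounded
(`EdgeWeights.exists_bounded_laplacian`), and its quadratic form is the energy
`½ ∑ π_{xy} (f y - f x)²`.

*Essential spectrum from test functions.* If unit vectors `u n` tend weakly to zero and have
Rayleigh quotients at most `c`, then `A` has essential spectrum in `(-∞, c]`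
(`exists_mem_pmapEssSpectrum_le`). Such vectors can be moved into any subspace of finite
codimension, so the number `l`, the supremum of the lower bounds of the form of `A` on subspaces of
finite codimension, is at most `c`. Suppose that `l` is at distance `δ` from the rest of the
spectrum and `ker (A - l)` is finite-dimensional. Then `|A - l| ≥ δ` on the complement of the kernel
(`mul_norm_le_norm_map_of_isolated`), whereas Cauchy–Schwarz for the form of `A - l + ε` on a
subspace of finite codimension yields vectors in that complement on which `A - l` is arbitrarily
small. No spectral theorem is needed: a gap `(0, δ)` in the spectrum of a positive operator `C`
(here `C = (A - l)²`, with gap `(0, δ²)`) is turned into `C (C - δ) ≥ 0` by factoring a quadratic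
polynomial, because the infimum of the form of a symmetric operator lies in its spectrum
(`inner_nonneg_of_isUnit`).

*Upper bound.* For `ν` above the volume growth `μ`, the functions
`f_j = exp (ν / 2 * (j - |ρ(x₀, ·) - j|))` are in `L²(θ)`, are bounded at each vertex uniformly in
`j`, and have norms tending to infinity as `θ` has infinite mass; normalized, they tend weakly to
zero. On every edge `(f y - f x)² ≤ (1 - E)² / (1 + E²) (f x² + f y²)` with `E = exp (M ν / 2)`, and
summing over the edges bounds the Rayleigh quotient by `growthBound m M ν`
(`lambdaEss_le_growthBound_of_lt`); then `ν` decreases to `μ`. For `μ = ∞` the indicator functions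
of single vertices suffice.

*Regular trees.* On the `(q + 1)`-regular tree the function `√q ^ (-d(x₀, ·))` is a positive
supersolution, which bounds the whole spectrum from below by the value of the growth bound at
`log q` (`le_lambdaEss_regularTree`). Counting spheres shows that the volume growth is at most
`log q`, and the growth bound is increasing, so the two estimates meet.
-/

/-! ### Symmetric operators on a real Hilbert space -/

section SymmetricOperator

variable {H : Type*} [NormedAddCommGroup H] [InnerProductSpace ℝ H]

theorem isSymmetric_sub_smul_one {K : H →L[ℝ] H} (hK : K.toLinearMap.IsSymmetric) (s : ℝ) :
    (K - s • (1 : H →L[ℝ] H)).toLinearMap.IsSymmetric := by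
  intro f g
  have := hK f g
  simp only [ContinuousLinearMap.coe_coe] at this
  simp [inner_sub_left, inner_sub_right, real_inner_smul_left, real_inner_smul_right, this]

theorem inner_sub_smul_one_self (K : H →L[ℝ] H) (s : ℝ) (f : H) :
    inner ℝ ((K - s • (1 : H →L[ℝ] H)) f) f = inner ℝ (K f) f - s * ‖f‖ ^ 2 := by
  simp [inner_sub_left, real_inner_smul_left]

/-- The Cauchy–Schwarz inequality for a quadratic form that is nonnegative on a subspace. -/
theorem norm_map_sq_le_of_nonneg_on {K : H →L[ℝ] H} (hK : K.toLinearMap.IsSymmetric)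
    {S : Submodule ℝ H} (hS : ∀ f ∈ S, 0 ≤ inner ℝ (K f) f) {c : ℝ} (hc : 0 < c)
    (hKc : ‖K‖ ≤ c) {f : H} (hf : f ∈ S) (hKf : K f ∈ S) :
    ‖K f‖ ^ 2 ≤ c * inner ℝ (K f) f := by
  -- The form is nonnegative at `f - c⁻¹ K f`.
  have h0 := hS _ (S.sub_mem hf (S.smul_mem c⁻¹ hKf))
  have h1 : inner ℝ (K (K f)) f = ‖K f‖ ^ 2 := by
    have := hK (K f) f
    simp only [ContinuousLinearMap.coe_coe] at this
    rw [this, real_inner_self_eq_norm_sq]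
  have h2 : inner ℝ (K (K f)) (K f) ≤ c * ‖K f‖ ^ 2 := by
    calc inner ℝ (K (K f)) (K f) ≤ ‖K (K f)‖ * ‖K f‖ := real_inner_le_norm _ _
      _ ≤ (c * ‖K f‖) * ‖K f‖ := by
          gcongr
          exact (K.le_opNorm _).trans (by gcongr)
      _ = _ := by ring
  simp only [map_sub, map_smul, inner_sub_left, inner_sub_right, real_inner_smul_left,
    real_inner_smul_right, h1, real_inner_self_eq_norm_sq] at h0
  have h3 : c⁻¹ * (c⁻¹ * inner ℝ (K (K f)) (K f)) ≤ c⁻¹ * ‖K f‖ ^ 2 := by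
    gcongr
    rw [inv_mul_le_iff₀ hc]
    exact h2
  have h4 : c⁻¹ * ‖K f‖ ^ 2 ≤ inner ℝ (K f) f := by linarith
  rwa [inv_mul_le_iff₀ hc] at h4

/-- If the form of a symmetric operator is bounded below by `-M` and there is no spectrum in
`[-M, 0)`, then the form is nonnegative: its infimum would be a point of the spectrum. -/
theorem inner_nonneg_of_isUnit {K : H →L[ℝ] H} (hK : K.toLinearMap.IsSymmetric) {M : ℝ}
    (hM : ∀ f, -M * ‖f‖ ^ 2 ≤ inner ℝ (K f) f)
    (hu : ∀ s, -M ≤ s → s < 0 → IsUnit (K - s • (1 : H →L[ℝ] H))) (f : H) :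
    0 ≤ inner ℝ (K f) f := by
  by_contra! hf
  set S : Set ℝ := {t | ∀ f, t * ‖f‖ ^ 2 ≤ inner ℝ (K f) f} with hS
  have hlt : ∀ t ∈ S, t < 0 := by
    intro t ht
    by_contra! h
    have := ht f
    have : 0 ≤ t * ‖f‖ ^ 2 := by positivity
    linarith [ht f]
  have hbdd : BddAbove S := ⟨0, fun t ht => (hlt t ht).le⟩
  have hne : S.Nonempty := ⟨-M, hM⟩
  set a := sSup S with ha
  have haS : a ∈ S := by
    have hcl : IsClosed S := by
      simp only [hS, Set.ofPred_forall]
      exact isClosed_iInter fun f => isClosed_le (by fun_prop) continuous_const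
    exact hcl.csSup_mem hne hbdd
  obtain ⟨u, hu⟩ := hu a (le_csSup hbdd hM) (hlt a haS)
  set K' := K - a • (1 : H →L[ℝ] H) with hK'
  set R : H →L[ℝ] H := ↑u⁻¹ with hR
  have hRK : ∀ g, R (K' g) = g := fun g => by
    have : R * K' = 1 := by rw [← hu, hR]; exact Units.inv_mul u
    simpa using congrArg (fun T : H →L[ℝ] H => T g) this
  set c := ‖K'‖ + 1
  have hc : 0 < c := by positivity
  have hpos : ∀ g, 0 ≤ inner ℝ (K' g) g := fun g => by
    rw [inner_sub_smul_one_self]; linarith [haS g]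
  have hbelow : ∀ g, ‖g‖ ^ 2 ≤ (‖R‖ ^ 2 * c + 1) * inner ℝ (K' g) g := by
    intro g
    have h1 := norm_map_sq_le_of_nonneg_on (isSymmetric_sub_smul_one hK a) (S := ⊤)
      (fun f _ => hpos f) hc (by simp only [c]; linarith) (f := g) trivial trivial
    have h2 : ‖g‖ ≤ ‖R‖ * ‖K' g‖ := by
      conv_lhs => rw [← hRK g]
      exact R.le_opNorm _
    calc ‖g‖ ^ 2 ≤ (‖R‖ * ‖K' g‖) ^ 2 := by gcongr
      _ = ‖R‖ ^ 2 * ‖K' g‖ ^ 2 := by ring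
      _ ≤ ‖R‖ ^ 2 * (c * inner ℝ (K' g) g) := by gcongr
      _ ≤ _ := by linarith [hpos g]
  set d := ‖R‖ ^ 2 * c + 1
  have hd : 0 < d := by positivity
  have : a + d⁻¹ ∈ S := by
    intro g
    have h1 := hbelow g
    rw [← inv_mul_le_iff₀ hd, hK', inner_sub_smul_one_self] at h1
    linarith
  have := le_csSup hbdd this
  have : 0 < d⁻¹ := by positivity
  linarith

/-- A gap `(0, δ)` in the spectrum of a symmetric operator `C` gives `C (C - δ) ≥ 0`. -/
theorem inner_map_le_norm_sq_of_gap {C : H →L[ℝ] H} (hC : C.toLinearMap.IsSymmetric) {δ : ℝ}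
    (hδ : 0 < δ) (hgap : ∀ s, 0 < s → s < δ → IsUnit (C - s • (1 : H →L[ℝ] H))) (f : H) :
    δ * inner ℝ (C f) f ≤ ‖C f‖ ^ 2 := by
  have hC' : ∀ f g, inner ℝ (C f) g = inner ℝ f (C g) := hC
  have hin : ∀ f, inner ℝ ((C * C - δ • C) f) f = ‖C f‖ ^ 2 - δ * inner ℝ (C f) f := fun f => by
    simp [inner_sub_left, real_inner_smul_left, hC' (C f) f]
  have hK : (C * C - δ • C).toLinearMap.IsSymmetric := by
    intro f g
    simp [inner_sub_left, inner_sub_right, real_inner_smul_left, real_inner_smul_right, hC']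
  have hu : ∀ s, -(δ ^ 2 / 4) ≤ s → s < 0 →
      IsUnit (C * C - δ • C - s • (1 : H →L[ℝ] H)) := by
    intro s hs hs0
    -- `r` and `δ - r` are the roots of `t ^ 2 - δ * t - s`.
    set q := √(δ ^ 2 + 4 * s)
    have hq : q ^ 2 = δ ^ 2 + 4 * s := Real.sq_sqrt (by linarith)
    have hq0 : 0 ≤ q := Real.sqrt_nonneg _
    have hqδ : q < δ := by nlinarith
    set r := (δ + q) / 2 with hr
    have hfac : C * C - δ • C - s • (1 : H →L[ℝ] H)
        = (C - r • (1 : H →L[ℝ] H)) * (C - (δ - r) • (1 : H →L[ℝ] H)) := by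
      have hs' : s = -(r * (δ - r)) := by rw [hr]; linarith
      ext f
      simp only [sub_apply, mul_apply_eq_comp,
        smul_apply, one_apply_eq_self, map_sub, map_smul]
      rw [hs']
      module
    rw [hfac]
    exact (hgap r (by linarith) (by linarith)).mul (hgap (δ - r) (by linarith) (by linarith))
  have hlow : ∀ f, -(δ ^ 2 / 4) * ‖f‖ ^ 2 ≤ inner ℝ ((C * C - δ • C) f) f := by
    intro f
    rw [hin]
    have h := sq_nonneg (‖C f‖ - δ / 2 * ‖f‖)
    have h2 : δ * inner ℝ (C f) f ≤ δ * (‖C f‖ * ‖f‖) := by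
      gcongr
      exact real_inner_le_norm _ _
    linarith
  have := inner_nonneg_of_isUnit hK hlow hu f
  rw [hin] at this
  linarith

/-- A positive operator with a spectral gap `(0, δ)` has no spectrum in `[0, δ)` on the orthogonal
complement of its kernel. -/
theorem mul_norm_sq_le_inner_of_gap [CompleteSpace H] {C : H →L[ℝ] H}
    (hC : C.toLinearMap.IsSymmetric) (hpos : ∀ f, 0 ≤ inner ℝ (C f) f) {δ : ℝ} (hδ : 0 < δ)
    (hgap : ∀ s, 0 < s → s < δ → IsUnit (C - s • (1 : H →L[ℝ] H))) {f : H} (hf : f ∈ C.kerᗮ) :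
    δ * ‖f‖ ^ 2 ≤ inner ℝ (C f) f := by
  have hrange : ∀ g, δ * ‖C g‖ ^ 2 ≤ inner ℝ (C (C g)) (C g) := by
    intro g
    -- The form of `C` is nonnegative at `g - δ⁻¹ C g`.
    have h0 := hpos (g - δ⁻¹ • C g)
    have h1 : inner ℝ (C (C g)) g = ‖C g‖ ^ 2 := by
      have := hC (C g) g
      simp only [ContinuousLinearMap.coe_coe] at this
      rw [this, real_inner_self_eq_norm_sq]
    have h2 := inner_map_le_norm_sq_of_gap hC hδ hgap g
    simp only [map_sub, map_smul, inner_sub_left, inner_sub_right, real_inner_smul_left,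
      real_inner_smul_right, h1, real_inner_self_eq_norm_sq] at h0
    have h3 : inner ℝ (C g) g ≤ δ⁻¹ * ‖C g‖ ^ 2 := by rwa [le_inv_mul_iff₀ hδ]
    have h4 : δ⁻¹ * ‖C g‖ ^ 2 ≤ δ⁻¹ * (δ⁻¹ * inner ℝ (C (C g)) (C g)) := by linarith
    rwa [mul_le_mul_iff_right₀ (inv_pos.2 hδ), le_inv_mul_iff₀ hδ] at h4
  rw [ContinuousLinearMap.orthogonal_ker, (ContinuousLinearMap.isSelfAdjoint_iff_isSymmetric.2
    hC).adjoint_eq] at hf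
  have hcl : IsClosed {f : H | δ * ‖f‖ ^ 2 ≤ inner ℝ (C f) f} :=
    isClosed_le (by fun_prop) (by fun_prop)
  refine closure_minimal ?_ hcl hf
  rintro _ ⟨g, rfl⟩
  exact hrange g

/-- If `0` is at distance at least `δ` from the rest of the spectrum of `B`, then `B` is bounded
below by `δ` on the orthogonal complement of its kernel. -/
theorem mul_norm_le_norm_map_of_isolated [CompleteSpace H] {B : H →L[ℝ] H}
    (hB : B.toLinearMap.IsSymmetric) {δ : ℝ} (hδ : 0 < δ)
    (hgap : ∀ s, s ≠ 0 → |s| < δ → IsUnit (B - s • (1 : H →L[ℝ] H))) {f : H} (hf : f ∈ B.kerᗮ) :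
    δ * ‖f‖ ≤ ‖B f‖ := by
  have hB' : ∀ f g, inner ℝ (B f) g = inner ℝ f (B g) := hB
  have hin : ∀ f, inner ℝ ((B * B) f) f = ‖B f‖ ^ 2 := fun f => by simp [hB' (B f) f]
  have hsym : (B * B).toLinearMap.IsSymmetric := fun f g => by simp [hB']
  have hker : (B * B).ker = B.ker := by
    ext g
    constructor
    · intro hg
      have h1 := hin g
      rw [LinearMap.mem_ker, ContinuousLinearMap.coe_coe] at hg
      rw [hg, inner_zero_left, eq_comm, sq_eq_zero_iff, norm_eq_zero] at h1
      simpa using h1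
    · intro hg
      rw [LinearMap.mem_ker, ContinuousLinearMap.coe_coe] at hg ⊢
      simp [hg]
  have key := mul_norm_sq_le_inner_of_gap hsym (fun f => by rw [hin]; positivity)
    (pow_pos hδ 2) (fun s hs hsδ => ?_) (hker ▸ hf)
  · rw [hin, ← mul_pow] at key
    exact le_of_sq_le_sq key (norm_nonneg _)
  · have hq : 0 < √s := Real.sqrt_pos.2 hs
    have hqδ : √s < δ := (Real.sqrt_lt' hδ).2 hsδ
    have hfac : B * B - s • (1 : H →L[ℝ] H)
        = (B - √s • (1 : H →L[ℝ] H)) * (B - (-√s) • (1 : H →L[ℝ] H)) := by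
      ext f
      simp only [sub_apply, mul_apply_eq_comp,
        smul_apply, one_apply_eq_self, map_sub, map_smul]
      conv_lhs => rw [← Real.mul_self_sqrt hs.le]
      module
    rw [hfac]
    exact (hgap _ hq.ne' (by rwa [abs_of_pos hq])).mul
      (hgap _ (neg_ne_zero.2 hq.ne') (by rwa [abs_neg, abs_of_pos hq]))

/-- The max-min principle for the bottom of the essential spectrum: if every subspace of finite
codimension contains vectors whose Rayleigh quotient is at most about `c`, then some `l ≤ c` is
either not isolated in the spectrum or an eigenvalue of infinite multiplicity. -/
theorem exists_le_not_isolated_or_infinite [CompleteSpace H] {A : H →L[ℝ] H}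
    (hA : A.toLinearMap.IsSymmetric) {c : ℝ}
    (h : ∀ F : Submodule ℝ H, FiniteDimensional ℝ F → ∀ ε > 0, ∃ f ∈ Fᗮ, f ≠ 0 ∧
      inner ℝ (A f) f ≤ (c + ε) * ‖f‖ ^ 2) :
    ∃ l ≤ c, ∀ δ > 0, (∀ s, s ≠ l → |s - l| < δ → IsUnit (A - s • (1 : H →L[ℝ] H))) →
      ¬ FiniteDimensional ℝ (A - l • (1 : H →L[ℝ] H)).ker := by
  -- `l` is the largest number such that the form is at least about `l` in finite codimension.
  set S : Set ℝ := {t | ∃ F : Submodule ℝ H, FiniteDimensional ℝ F ∧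
    ∀ f ∈ Fᗮ, t * ‖f‖ ^ 2 ≤ inner ℝ (A f) f} with hS
  have hle : ∀ t ∈ S, t ≤ c := by
    rintro t ⟨F, hF, ht⟩
    refine le_of_forall_pos_le_add fun ε hε => ?_
    obtain ⟨f, hfF, hf0, hf⟩ := h F hF ε hε
    have hpos : 0 < ‖f‖ ^ 2 := by positivity
    exact le_of_mul_le_mul_right ((ht f hfF).trans hf) hpos
  have hne : S.Nonempty := by
    refine ⟨-‖A‖, ⊥, inferInstance, fun f _ => ?_⟩
    have h1 := (abs_le.1 (abs_real_inner_le_norm (A f) f)).1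
    have h2 : ‖A f‖ * ‖f‖ ≤ ‖A‖ * ‖f‖ * ‖f‖ := by gcongr; exact A.le_opNorm f
    nlinarith
  have hbdd : BddAbove S := ⟨c, hle⟩
  set l := sSup S
  refine ⟨l, csSup_le hne hle, fun δ hδ hgap hfin => ?_⟩
  set B := A - l • (1 : H →L[ℝ] H) with hBdef
  have hB : B.toLinearMap.IsSymmetric := isSymmetric_sub_smul_one hA l
  set b := ‖B‖ + 2 with hb
  have hb0 : 2 ≤ b := by rw [hb]; linarith [norm_nonneg B]
  obtain ⟨ε, hε, hε1, hεδ⟩ : ∃ ε : ℝ, 0 < ε ∧ ε ≤ 1 ∧ 2 * b * ε + 2 * ε < δ ^ 2 / 4 := by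
    refine ⟨min 1 (δ ^ 2 / (16 * (b + 1))), by positivity, min_le_left _ _, ?_⟩
    have h1 : min 1 (δ ^ 2 / (16 * (b + 1))) ≤ δ ^ 2 / (16 * (b + 1)) := min_le_right _ _
    rw [le_div_iff₀ (by positivity)] at h1
    have h2 : 0 < δ ^ 2 := by positivity
    linarith
  obtain ⟨t, ⟨F, hF, hFt⟩, htl⟩ := exists_lt_of_lt_csSup hne (show l - ε < l by linarith)
  set F' : Submodule ℝ H := B.ker ⊔ F ⊔ F.map B.toLinearMap with hF'
  have hF'fin : FiniteDimensional ℝ F' := by infer_instance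
  obtain ⟨f, hfF', hfl⟩ : ∃ f ∈ F'ᗮ, inner ℝ (A f) f < (l + ε) * ‖f‖ ^ 2 := by
    by_contra! hcon
    have := le_csSup hbdd (show l + ε ∈ S from ⟨F', hF'fin, hcon⟩)
    linarith
  have hf0 : 0 < ‖f‖ := by
    rw [norm_pos_iff]
    rintro rfl
    simp at hfl
  have hfker : f ∈ B.kerᗮ := Submodule.orthogonal_le (le_sup_left.trans le_sup_left) hfF'
  have hfF : f ∈ Fᗮ := Submodule.orthogonal_le (le_sup_right.trans le_sup_left) hfF'
  have hBf : B f ∈ Fᗮ := by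
    intro g hg
    have h1 := hB g f
    simp only [ContinuousLinearMap.coe_coe] at h1
    rw [← h1]
    exact Submodule.orthogonal_le le_sup_right hfF' _
      (Submodule.mem_map_of_mem (f := B.toLinearMap) hg)
  -- `B + ε` is nonnegative on `Fᗮ`, and its form is small at `f`.
  set K := B - (-ε) • (1 : H →L[ℝ] H) with hKdef
  have hK : K.toLinearMap.IsSymmetric := isSymmetric_sub_smul_one hB _
  have hKpos : ∀ g ∈ Fᗮ, 0 ≤ inner ℝ (K g) g := by
    intro g hg
    rw [inner_sub_smul_one_self, inner_sub_smul_one_self]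
    have := hFt g hg
    nlinarith [sq_nonneg ‖g‖]
  have hKf : K f = B f + ε • f := by simp [hKdef]
  have hKnorm : ‖K‖ ≤ b := by
    have h1 : ‖(-ε) • (1 : H →L[ℝ] H)‖ ≤ 1 := by
      rw [norm_smul, norm_neg, Real.norm_of_nonneg hε.le]
      calc ε * ‖(1 : H →L[ℝ] H)‖ ≤ 1 * 1 := by
            gcongr
            exact ContinuousLinearMap.norm_id_le
        _ = 1 := one_mul 1
    linarith [norm_sub_le B ((-ε) • (1 : H →L[ℝ] H))]
  have h1 := norm_map_sq_le_of_nonneg_on hK hKpos (by linarith) hKnorm hfF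
    (by rw [hKf]; exact Submodule.add_mem _ hBf (Submodule.smul_mem _ _ hfF))
  have h2 : inner ℝ (K f) f ≤ 2 * ε * ‖f‖ ^ 2 := by
    rw [inner_sub_smul_one_self, inner_sub_smul_one_self]
    linarith
  have h3 : δ * ‖f‖ ≤ ‖B f‖ := by
    refine mul_norm_le_norm_map_of_isolated hB hδ (fun s hs hsδ => ?_) hfker
    have := hgap (l + s) (by simpa using hs) (by simpa using hsδ)
    rwa [add_smul, ← sub_sub] at this
  have h4 : ‖B f‖ ≤ ‖K f‖ + ε * ‖f‖ := by
    have : B f = K f - ε • f := by rw [hKf]; abel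
    rw [this]
    refine (norm_sub_le _ _).trans ?_
    rw [norm_smul, Real.norm_of_nonneg hε.le]
  have h5 : ‖K f‖ ^ 2 ≤ (2 * b * ε) * ‖f‖ ^ 2 := by
    refine h1.trans ?_
    calc b * inner ℝ (K f) f ≤ b * (2 * ε * ‖f‖ ^ 2) := by gcongr
      _ = _ := by ring
  have h6 : (δ * ‖f‖) ^ 2 ≤ 2 * ‖K f‖ ^ 2 + 2 * (ε * ‖f‖) ^ 2 := by
    calc (δ * ‖f‖) ^ 2 ≤ (‖K f‖ + ε * ‖f‖) ^ 2 := by gcongr; exact h3.trans h4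
      _ ≤ _ := by nlinarith [sq_nonneg (‖K f‖ - ε * ‖f‖)]
  have h7 : ε ^ 2 ≤ ε := by nlinarith
  have h8 : 0 < ‖f‖ ^ 2 := by positivity
  nlinarith

/-- A bounded sequence is weakly null as soon as its inner products with a total set tend to
zero. -/
theorem tendsto_inner_zero_of_total [CompleteSpace H] {u : ℕ → H} {C : ℝ} (hu : ∀ n, ‖u n‖ ≤ C)
    {s : Set H} (hs : ∀ f, (∀ g ∈ s, inner ℝ g f = 0) → f = 0)
    (h : ∀ g ∈ s, Tendsto (fun n => inner ℝ g (u n)) atTop (𝓝 0)) (g : H) :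
    Tendsto (fun n => inner ℝ g (u n)) atTop (𝓝 0) := by
  have hC : 0 ≤ C := (norm_nonneg _).trans (hu 0)
  have hspan : ∀ g ∈ Submodule.span ℝ s, Tendsto (fun n => inner ℝ g (u n)) atTop (𝓝 0) := by
    intro g hg
    induction hg using Submodule.span_induction with
    | mem x hx => exact h x hx
    | zero => simp
    | add x y _ _ hx hy => simpa [inner_add_left] using hx.add hy
    | smul a x _ hx => simpa [real_inner_smul_left] using hx.const_mul a
  have hdense : (Submodule.span ℝ s).topologicalClosure = ⊤ := by
    rw [Submodule.topologicalClosure_eq_top_iff, Submodule.eq_bot_iff]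
    exact fun f hf => hs f fun g hg => hf g (Submodule.subset_span hg)
  rw [Metric.tendsto_atTop]
  intro ε hε
  have hg : g ∈ closure (Submodule.span ℝ s : Set H) := by
    rw [← Submodule.topologicalClosure_coe, hdense]; trivial
  obtain ⟨g', hg', hgg'⟩ := Metric.mem_closure_iff.1 hg (ε / (2 * (C + 1))) (by positivity)
  obtain ⟨N, hN⟩ := Metric.tendsto_atTop.1 (hspan g' hg') (ε / 2) (by positivity)
  refine ⟨N, fun n hn => ?_⟩
  have h1 := hN n hn
  rw [Real.dist_eq, sub_zero] at h1 ⊢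
  rw [dist_eq_norm] at hgg'
  have h2 : |inner ℝ (g - g') (u n)| ≤ ε / 2 := by
    calc |inner ℝ (g - g') (u n)| ≤ ‖g - g'‖ * ‖u n‖ := abs_real_inner_le_norm _ _
      _ ≤ ε / (2 * (C + 1)) * (C + 1) := by
          gcongr
          exact (hu n).trans (by linarith)
      _ = ε / 2 := by field_simp
  have h3 : inner ℝ g (u n) = inner ℝ (g - g') (u n) + inner ℝ g' (u n) := by
    rw [← inner_add_left, sub_add_cancel]
  rw [h3]
  linarith [abs_add_le (inner ℝ (g - g') (u n)) (inner ℝ g' (u n))]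

/-- A weakly null sequence of unit vectors with Rayleigh quotients at most `c` yields vectors with
Rayleigh quotient about `c` in every subspace of finite codimension. -/
theorem exists_mem_orthogonal_of_weakly_null [CompleteSpace H] {A : H →L[ℝ] H}
    (hA : A.toLinearMap.IsSymmetric) {c : ℝ} {u : ℕ → H} (hu : ∀ n, ‖u n‖ = 1)
    (hw : ∀ g, Tendsto (fun n => inner ℝ g (u n)) atTop (𝓝 0))
    (hAu : ∀ n, inner ℝ (A (u n)) (u n) ≤ c) (F : Submodule ℝ H) [FiniteDimensional ℝ F]
    {ε : ℝ} (hε : 0 < ε) : ∃ f ∈ Fᗮ, f ≠ 0 ∧ inner ℝ (A f) f ≤ (c + ε) * ‖f‖ ^ 2 := by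
  set P := F.starProjection with hP
  have hPu : Tendsto (fun n => P (u n)) atTop (𝓝 0) := by
    have h1 : ∀ n, P (u n) = ∑ i, inner ℝ ((stdOrthonormalBasis ℝ F i : F) : H) (u n) •
        ((stdOrthonormalBasis ℝ F i : F) : H) := by
      intro n
      rw [hP, Submodule.starProjection_apply,
        (stdOrthonormalBasis ℝ F).orthogonalProjectionOnto_apply_eq_sum]
      simp
    simp_rw [h1]
    rw [← Finset.sum_const_zero (s := (Finset.univ : Finset (Fin (Module.finrank ℝ F))))]
    refine tendsto_finsetSum _ fun i _ => ?_
    simpa using (hw ((stdOrthonormalBasis ℝ F i : F) : H)).smul_const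
      ((stdOrthonormalBasis ℝ F i : F) : H)
  set p : ℕ → ℝ := fun n => ‖P (u n)‖ with hp
  have hp0 : Tendsto p atTop (𝓝 0) := by simpa using hPu.norm
  -- Replacing `u n` by its component in `Fᗮ` changes form and norm by `O(p n)`.
  have hlim : Tendsto (fun n => c + 2 * ‖A‖ * p n + ‖A‖ * p n ^ 2 - (c + ε) * (1 - p n ^ 2)) atTop
      (𝓝 (c + 2 * ‖A‖ * 0 + ‖A‖ * 0 ^ 2 - (c + ε) * (1 - 0 ^ 2))) := by
    refine Tendsto.sub (Tendsto.add (Tendsto.add tendsto_const_nhds (hp0.const_mul _))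
      ((hp0.pow 2).const_mul _)) (Tendsto.const_mul _ (tendsto_const_nhds.sub (hp0.pow 2)))
  have hev := hlim.eventually (gt_mem_nhds (show _ < (0 : ℝ) by ring_nf; linarith))
  have hev' := hp0.eventually (gt_mem_nhds (show (0 : ℝ) < 1 by norm_num))
  obtain ⟨n, hn, hn1⟩ := (hev.and hev').exists
  have horth : u n - P (u n) ∈ Fᗮ := F.sub_starProjection_mem_orthogonal (u n)
  have hmem : P (u n) ∈ F := F.starProjection_apply_mem (u n)
  have hnorm : ‖u n - P (u n)‖ ^ 2 = 1 - p n ^ 2 := by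
    have h1 : inner ℝ (P (u n)) (u n - P (u n)) = 0 := horth _ hmem
    have h2 := norm_add_sq_real (P (u n)) (u n - P (u n))
    rw [h1, add_sub_cancel, hu n] at h2
    simp only [hp]
    linarith
  refine ⟨u n - P (u n), horth, ?_, ?_⟩
  · intro h0
    rw [h0, norm_zero] at hnorm
    have : 0 ≤ p n := norm_nonneg _
    nlinarith
  · have hsym : inner ℝ (A (P (u n))) (u n) = inner ℝ (A (u n)) (P (u n)) := by
      have := hA (P (u n)) (u n)
      simp only [ContinuousLinearMap.coe_coe] at this
      rw [this, real_inner_comm]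
    have h1 : |inner ℝ (A (u n)) (P (u n))| ≤ ‖A‖ * p n := by
      refine (abs_real_inner_le_norm _ _).trans ?_
      have := A.le_opNorm (u n)
      rw [hu n, mul_one] at this
      gcongr
    have h2 : inner ℝ (A (P (u n))) (P (u n)) ≤ ‖A‖ * p n ^ 2 := by
      calc _ ≤ ‖A (P (u n))‖ * ‖P (u n)‖ := real_inner_le_norm _ _
        _ ≤ (‖A‖ * ‖P (u n)‖) * ‖P (u n)‖ := by gcongr; exact A.le_opNorm _
        _ = _ := by ring
    have h3 := (abs_le.1 h1).1
    rw [hnorm]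
    simp only [map_sub, inner_sub_left, inner_sub_right, hsym]
    linarith [hAu n]

end SymmetricOperator

/-! ### Everywhere defined operators -/

section EverywhereDefined

variable {H : Type*} [NormedAddCommGroup H] [NormedSpace ℝ H]

/-- For an everywhere defined operator, the resolvent set is the usual one. -/
theorem mem_pmapResolventSet_iff {T : H →ₗ.[ℝ] H} {A : H →L[ℝ] H} (hdom : T.domain = ⊤)
    (hA : ∀ f : T.domain, T f = A f) (z : ℝ) :
    z ∈ pmapResolventSet T ↔ IsUnit (A - z • (1 : H →L[ℝ] H)) := by
  have hmem : ∀ f : H, f ∈ T.domain := fun f => hdom ▸ Submodule.mem_top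
  constructor
  · rintro ⟨R, h1, h2⟩
    refine ⟨⟨A - z • (1 : H →L[ℝ] H), R, ?_, ?_⟩, rfl⟩
    · ext u
      obtain ⟨h, hu⟩ := h1 u
      rw [hA] at hu
      simpa using hu
    · ext f
      have := h2 ⟨f, hmem f⟩
      rw [hA] at this
      simpa using this
  · rintro ⟨u, hu⟩
    refine ⟨↑u⁻¹, fun f => ⟨hmem _, ?_⟩, fun f => ?_⟩
    · rw [hA]
      have : (A - z • (1 : H →L[ℝ] H)) * ↑u⁻¹ = 1 := by rw [← hu]; exact Units.mul_inv u
      simpa using congrArg (fun T : H →L[ℝ] H => T f) this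
    · rw [hA]
      have : ↑u⁻¹ * (A - z • (1 : H →L[ℝ] H)) = 1 := by rw [← hu]; exact Units.inv_mul u
      simpa using congrArg (fun T : H →L[ℝ] H => T f) this

theorem finiteDimensional_ker_of_eigenspace {T : H →ₗ.[ℝ] H} {A : H →L[ℝ] H}
    (hdom : T.domain = ⊤) (hA : ∀ f : T.domain, T f = A f) {z : ℝ}
    (hfin : FiniteDimensional ℝ (pmapEigenspace T z)) :
    FiniteDimensional ℝ (A - z • (1 : H →L[ℝ] H)).ker := by
  have : (A - z • (1 : H →L[ℝ] H)).ker = (pmapEigenspace T z).map T.domain.subtype := by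
    ext f
    simp only [Submodule.mem_map, LinearMap.mem_ker, pmapEigenspace]
    constructor
    · intro hf
      refine ⟨⟨f, hdom ▸ Submodule.mem_top⟩, ?_, rfl⟩
      have := hA ⟨f, hdom ▸ Submodule.mem_top⟩
      simp only [LinearPMap.toFun_eq_coe, LinearMap.sub_apply, LinearMap.smul_apply, this]
      simpa using hf
    · rintro ⟨g, hg, rfl⟩
      simp only [LinearPMap.toFun_eq_coe, LinearMap.sub_apply, LinearMap.smul_apply, hA] at hg
      simpa using hg
  rw [this]
  infer_instance

end EverywhereDefined

section EssentialSpectrum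

variable {H : Type*} [NormedAddCommGroup H] [InnerProductSpace ℝ H] [CompleteSpace H]

/-- A weakly null sequence of unit vectors with Rayleigh quotients at most `c` forces essential
spectrum in `(-∞, c]`. -/
theorem exists_mem_pmapEssSpectrum_le {T : H →ₗ.[ℝ] H} {A : H →L[ℝ] H} (hdom : T.domain = ⊤)
    (hTA : ∀ f : T.domain, T f = A f) (hA : A.toLinearMap.IsSymmetric) {c : ℝ} {u : ℕ → H}
    (hu : ∀ n, ‖u n‖ = 1) (hw : ∀ g, Tendsto (fun n => inner ℝ g (u n)) atTop (𝓝 0))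
    (hAu : ∀ n, inner ℝ (A (u n)) (u n) ≤ c) : ∃ l ∈ pmapEssSpectrum T, l ≤ c := by
  obtain ⟨l, hlc, hl⟩ := exists_le_not_isolated_or_infinite hA (c := c)
    fun F hF ε hε => exists_mem_orthogonal_of_weakly_null hA hu hw hAu F hε
  refine ⟨l, ?_, hlc⟩
  by_contra hnot
  have hgap : ∃ δ > 0, ∀ s, s ≠ l → |s - l| < δ → s ∈ pmapResolventSet T := by
    by_contra! hcon
    have hacc : AccPt l (𝓟 (pmapSpectrum T)) := by
      rw [accPt_iff_nhds]
      intro U hU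
      obtain ⟨δ, hδ, hδU⟩ := Metric.mem_nhds_iff.1 hU
      obtain ⟨s, hs, hsδ, hsT⟩ := hcon δ hδ
      exact ⟨s, ⟨hδU (by rwa [Metric.mem_ball, Real.dist_eq]), hsT⟩, hs⟩
    refine hnot ⟨?_, Or.inl hacc⟩
    -- The spectrum is closed, so it contains its accumulation points.
    have hcl : IsClosed (pmapSpectrum T) := by
      have : pmapSpectrum T = (fun z : ℝ => A - z • (1 : H →L[ℝ] H)) ⁻¹' {B | IsUnit B}ᶜ := by
        ext z
        simp [pmapSpectrum, mem_pmapResolventSet_iff hdom hTA]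
      rw [this]
      exact Units.isOpen.isClosed_compl.preimage (by fun_prop)
    exact hcl.closure_subset (mem_closure_iff_clusterPt.2 hacc.clusterPt)
  obtain ⟨δ, hδ, hδT⟩ := hgap
  refine hl δ hδ (fun s hs hsδ => (mem_pmapResolventSet_iff hdom hTA s).1 (hδT s hs hsδ)) ?_
  by_cases hsp : l ∈ pmapSpectrum T
  · refine finiteDimensional_ker_of_eigenspace hdom hTA ?_
    by_contra hinf
    exact hnot ⟨hsp, Or.inr hinf⟩
  · have hunit := (mem_pmapResolventSet_iff hdom hTA l).1 (not_not.1 hsp)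
    have : (A - l • (1 : H →L[ℝ] H)).ker = ⊥ :=
      LinearMap.ker_eq_bot.2 (ContinuousLinearMap.isUnit_iff_bijective.1 hunit).1
    rw [this]
    infer_instance

/-- The spectrum of an everywhere defined bounded operator with form bounded below by `c` lies in
`[c, ∞)`. -/
theorem le_of_mem_pmapSpectrum {T : H →ₗ.[ℝ] H} {A : H →L[ℝ] H} (hdom : T.domain = ⊤)
    (hTA : ∀ f : T.domain, T f = A f) {c : ℝ} (hc : ∀ f, c * ‖f‖ ^ 2 ≤ inner ℝ (A f) f) {z : ℝ}
    (hz : z ∈ pmapSpectrum T) : c ≤ z := by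
  by_contra! hzc
  refine hz ((mem_pmapResolventSet_iff hdom hTA z).2 ?_)
  refine ContinuousLinearMap.isUnit_of_forall_le_norm_inner_map (𝕜 := ℝ) _
    (c := (c - z).toNNReal) (by simpa using hzc) fun f => ?_
  rw [inner_sub_smul_one_self, Real.coe_toNNReal _ (by linarith)]
  refine le_trans ?_ (le_abs_self _)
  linarith [hc f]

end EssentialSpectrum

/-! ### The space `L²(θ)` -/

section VertexMeasure

variable {G : Type*} [MeasurableSpace G] [DiscreteMeasurableSpace G] {θ : G → ℝ}

theorem vertexMeasure_apply (θ : G → ℝ) (U : Set G) :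
    vertexMeasure θ U = ∑' x, U.indicator (fun x => ENNReal.ofReal (θ x)) x := by
  rw [vertexMeasure, Measure.sum_apply _ MeasurableSet.of_discrete]
  refine tsum_congr fun x => ?_
  by_cases hx : x ∈ U <;> simp [hx]

theorem integrable_vertexMeasure_iff [Countable G] (hθ : ∀ x, 0 < θ x) {f : G → ℝ} :
    Integrable f (vertexMeasure θ) ↔ Summable fun x => θ x * |f x| := by
  rw [vertexMeasure, integrable_sum_dirac_iff (fun _ => ENNReal.ofReal_ne_top)]
  simp only [ENNReal.toReal_ofReal (hθ _).le, Real.norm_eq_abs]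

theorem hasSum_integral_vertexMeasure (hθ : ∀ x, 0 < θ x) {f : G → ℝ}
    (hf : Integrable f (vertexMeasure θ)) :
    HasSum (fun x => θ x * f x) (∫ x, f x ∂vertexMeasure θ) := by
  rw [vertexMeasure] at hf ⊢
  have := hasSum_integral_measure hf
  simpa only [integral_smul_measure, integral_dirac, ENNReal.toReal_ofReal (hθ _).le,
    smul_eq_mul] using this

theorem memLp_vertexMeasure_iff [Countable G] (hθ : ∀ x, 0 < θ x) {f : G → ℝ} :
    MemLp f 2 (vertexMeasure θ) ↔ Summable fun x => θ x * f x ^ 2 := by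
  rw [memLp_two_iff_integrable_sq (Measurable.of_discrete).aestronglyMeasurable,
    integrable_vertexMeasure_iff hθ]
  simp

theorem coeFn_toLp_vertexMeasure (hθ : ∀ x, 0 < θ x) {f : G → ℝ}
    (hf : MemLp f 2 (vertexMeasure θ)) : (hf.toLp f : G → ℝ) = f :=
  eq_of_ae_eq_vertexMeasure hθ hf.coeFn_toLp

theorem hasSum_inner_vertexMeasure (hθ : ∀ x, 0 < θ x) (f g : Lp ℝ 2 (vertexMeasure θ)) :
    HasSum (fun x => θ x * (f x * g x)) (inner ℝ f g) := by
  have := hasSum_integral_vertexMeasure hθ (L2.integrable_inner (𝕜 := ℝ) f g)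
  rw [L2.inner_def]
  simpa [mul_comm] using this

theorem hasSum_norm_sq_vertexMeasure (hθ : ∀ x, 0 < θ x) (f : Lp ℝ 2 (vertexMeasure θ)) :
    HasSum (fun x => θ x * f x ^ 2) (‖f‖ ^ 2) := by
  rw [← real_inner_self_eq_norm_sq]
  simpa [sq] using hasSum_inner_vertexMeasure hθ f f

end VertexMeasure

/-! ### The Laplacian as a bounded operator -/

namespace EdgeWeights

variable {G : Type*} {Γ : SimpleGraph G} (w : EdgeWeights Γ)

theorem weight_eq_zero {x y : G} (h : ¬ Γ.Adj x y) : w.weight x y = 0 :=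
  le_antisymm (not_lt.1 fun h' => h ((w.pos_iff x y).1 h')) (w.nonneg x y)

variable [Γ.LocallyFinite]

theorem hasSum_weight_mul (f : G → ℝ) (x : G) :
    HasSum (fun y => w.weight x y * f y) (∑ y ∈ Γ.neighborFinset x, w.weight x y * f y) := by
  refine hasSum_sum_of_ne_finset_zero fun y hy => ?_
  rw [w.weight_eq_zero (by simpa using hy), zero_mul]

variable {w} {θ : G → ℝ} {C : ℝ}

/-- The hypothesis `π_x ≤ C θ_x` makes the form `∑ π_{xy} f(x)²` bounded on `L²(θ)`. -/
theorem hasSum_weight_mul_fst_sq (hC : ∀ x, w.vertexWeight x ≤ C * θ x) {f : G → ℝ}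
    (hf : Summable fun x => θ x * f x ^ 2) :
    HasSum (fun p : G × G => w.weight p.1 p.2 * f p.1 ^ 2)
      (∑' x, w.vertexWeight x * f x ^ 2) := by
  have hfib : ∀ x, HasSum (fun y => w.weight x y * f x ^ 2) (w.vertexWeight x * f x ^ 2) := by
    intro x
    simpa [vertexWeight, Finset.sum_mul] using w.hasSum_weight_mul (fun _ => f x ^ 2) x
  have hs : Summable fun p : G × G => w.weight p.1 p.2 * f p.1 ^ 2 := by
    rw [summable_prod_of_nonneg fun p => mul_nonneg (w.nonneg _ _) (sq_nonneg _)]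
    refine ⟨fun x => (hfib x).summable, ?_⟩
    simp_rw [(hfib _).tsum_eq]
    refine Summable.of_nonneg_of_le (fun x => mul_nonneg (Finset.sum_nonneg fun y _ =>
      w.nonneg x y) (sq_nonneg _)) (fun x => ?_) (hf.mul_left C)
    rw [← mul_assoc]
    exact mul_le_mul_of_nonneg_right (hC x) (sq_nonneg _)
  have := hs.hasSum
  rwa [← (this.prod_fiberwise hfib).tsum_eq] at this

theorem hasSum_weight_mul_snd_sq (hC : ∀ x, w.vertexWeight x ≤ C * θ x) {f : G → ℝ}
    (hf : Summable fun x => θ x * f x ^ 2) :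
    HasSum (fun p : G × G => w.weight p.1 p.2 * f p.2 ^ 2)
      (∑' x, w.vertexWeight x * f x ^ 2) := by
  have := (Equiv.prodComm G G).hasSum_iff.2 (hasSum_weight_mul_fst_sq hC hf)
  refine this.congr_fun fun p => ?_
  simp [w.symm p.1 p.2]

theorem tsum_vertexWeight_mul_sq_le (hC : ∀ x, w.vertexWeight x ≤ C * θ x) {f : G → ℝ}
    (hf : Summable fun x => θ x * f x ^ 2) :
    ∑' x, w.vertexWeight x * f x ^ 2 ≤ C * ∑' x, θ x * f x ^ 2 := by
  have h0 : ∀ x, 0 ≤ w.vertexWeight x := fun x => Finset.sum_nonneg fun y _ => w.nonneg x y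
  have h1 : ∀ x, w.vertexWeight x * f x ^ 2 ≤ C * (θ x * f x ^ 2) := fun x => by
    rw [← mul_assoc]
    exact mul_le_mul_of_nonneg_right (hC x) (sq_nonneg _)
  rw [← tsum_mul_left]
  exact (Summable.of_nonneg_of_le (fun x => mul_nonneg (h0 x) (sq_nonneg _)) h1
    (hf.mul_left C)).tsum_le_tsum h1 (hf.mul_left C)

/-- The energy of a function in `L²(θ)` is finite. -/
theorem summable_energy (hC : ∀ x, w.vertexWeight x ≤ C * θ x) {f : G → ℝ}
    (hf : Summable fun x => θ x * f x ^ 2) :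
    Summable fun p : G × G => w.weight p.1 p.2 * (f p.2 - f p.1) ^ 2 := by
  refine Summable.of_nonneg_of_le (fun p => mul_nonneg (w.nonneg _ _) (sq_nonneg _)) (fun p => ?_)
    (((hasSum_weight_mul_fst_sq hC hf).summable.add
      (hasSum_weight_mul_snd_sq hC hf).summable).mul_left 2)
  have := mul_nonneg (w.nonneg p.1 p.2) (sq_nonneg (f p.2 + f p.1))
  nlinarith

/-- By the Cauchy–Schwarz inequality, `𝓛_θ` maps `L²(θ)` to itself if `π_x ≤ C θ_x`. -/
theorem summable_laplacianFun_sq (hθ : ∀ x, 0 < θ x) (hC : ∀ x, w.vertexWeight x ≤ C * θ x)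
    {f : G → ℝ} (hf : Summable fun x => θ x * f x ^ 2) :
    Summable fun x => θ x * laplacianFun w θ f x ^ 2 := by
  have hfib : ∀ x, HasSum (fun y => w.weight x y * (f y - f x) ^ 2)
      (∑ y ∈ Γ.neighborFinset x, w.weight x y * (f y - f x) ^ 2) :=
    fun x => w.hasSum_weight_mul (fun y => (f y - f x) ^ 2) x
  have hs := ((summable_energy hC hf).hasSum.prod_fiberwise hfib).summable.mul_left C
  refine Summable.of_nonneg_of_le (fun x => mul_nonneg (hθ x).le (sq_nonneg _)) (fun x => ?_) hs
  have hCS : (∑ y ∈ Γ.neighborFinset x, w.weight x y * (f y - f x)) ^ 2 ≤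
      w.vertexWeight x * ∑ y ∈ Γ.neighborFinset x, w.weight x y * (f y - f x) ^ 2 := by
    refine Finset.sum_sq_le_sum_mul_sum_of_sq_le_mul _ (fun y _ => w.nonneg x y)
      (fun y _ => mul_nonneg (w.nonneg x y) (sq_nonneg _)) fun y _ => le_of_eq (by ring)
  have hE : 0 ≤ ∑ y ∈ Γ.neighborFinset x, w.weight x y * (f y - f x) ^ 2 :=
    Finset.sum_nonneg fun y _ => mul_nonneg (w.nonneg x y) (sq_nonneg _)
  have h1 := hCS.trans (mul_le_mul_of_nonneg_right (hC x) hE)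
  have h2 : θ x * laplacianFun w θ f x ^ 2 =
      1 / θ x * (∑ y ∈ Γ.neighborFinset x, w.weight x y * (f y - f x)) ^ 2 := by
    rw [laplacianFun]
    field_simp [(hθ x).ne']
  rw [h2, div_mul_eq_mul_div, one_mul, div_le_iff₀ (hθ x)]
  linarith

/-- Green's formula for functions in `L²(θ)`. -/
theorem hasSum_green (hθ : ∀ x, 0 < θ x) (hC : ∀ x, w.vertexWeight x ≤ C * θ x) {f g : G → ℝ}
    (hf : Summable fun x => θ x * f x ^ 2) (hg : Summable fun x => θ x * g x ^ 2) {a : ℝ}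
    (ha : HasSum (fun x => θ x * (laplacianFun w θ f x * g x)) a) :
    HasSum (fun p : G × G => w.weight p.1 p.2 * ((f p.2 - f p.1) * (g p.2 - g p.1)))
      (-(2 * a)) := by
  have hs : Summable fun p : G × G => w.weight p.1 p.2 * ((f p.2 - f p.1) * g p.1) := by
    refine Summable.of_norm_bounded (((summable_energy hC hf).add
      (hasSum_weight_mul_fst_sq hC hg).summable)) fun p => ?_
    rw [Real.norm_eq_abs, abs_mul, abs_of_nonneg (w.nonneg _ _), ← mul_add]
    refine mul_le_mul_of_nonneg_left ?_ (w.nonneg _ _)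
    rw [abs_mul]
    nlinarith [sq_abs (f p.2 - f p.1), sq_abs (g p.1), sq_nonneg (|f p.2 - f p.1| - |g p.1|),
      abs_nonneg (f p.2 - f p.1), abs_nonneg (g p.1)]
  have hfib : ∀ x, HasSum (fun y => w.weight x y * ((f y - f x) * g x))
      (θ x * (laplacianFun w θ f x * g x)) := by
    intro x
    have h1 := w.hasSum_weight_mul (fun y => (f y - f x) * g x) x
    have h2 : ∑ y ∈ Γ.neighborFinset x, w.weight x y * ((f y - f x) * g x) =
        θ x * (laplacianFun w θ f x * g x) := by
      rw [laplacianFun, Finset.mul_sum, Finset.sum_mul, Finset.mul_sum]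
      refine Finset.sum_congr rfl fun y _ => ?_
      field_simp [(hθ x).ne']
    rwa [h2] at h1
  have h1 : HasSum (fun p : G × G => w.weight p.1 p.2 * ((f p.2 - f p.1) * g p.1)) a := by
    have := hs.hasSum
    rwa [(this.prod_fiberwise hfib).unique ha] at this
  have h2 := ((Equiv.prodComm G G).hasSum_iff.2 h1)
  have h3 := (h1.add h2).neg
  rw [← two_mul] at h3
  refine h3.congr_fun fun p => ?_
  simp only [Function.comp_apply, Equiv.prodComm_apply, Prod.fst_swap, Prod.snd_swap,
    w.symm p.2 p.1]
  ring

/-- If `π_x ≤ C θ_x`, then `-𝓛_θ` is an everywhere defined bounded symmetric operator, and its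
quadratic form is the energy form. -/
theorem exists_bounded_laplacian [Countable G] [MeasurableSpace G] [DiscreteMeasurableSpace G]
    (hθ : ∀ x, 0 < θ x) (hC : ∀ x, w.vertexWeight x ≤ C * θ x) :
    (-laplacian w θ hθ).domain = ⊤ ∧
    ∃ A : Lp ℝ 2 (vertexMeasure θ) →L[ℝ] Lp ℝ 2 (vertexMeasure θ),
      (∀ f : (-laplacian w θ hθ).domain, (-laplacian w θ hθ) f = A f) ∧
      A.toLinearMap.IsSymmetric ∧
      ∀ f : Lp ℝ 2 (vertexMeasure θ), HasSum
        (fun p : G × G => w.weight p.1 p.2 * (f p.2 - f p.1) ^ 2) (2 * inner ℝ (A f) f) := by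
  have hsum : ∀ f : Lp ℝ 2 (vertexMeasure θ), Summable fun x => θ x * f x ^ 2 :=
    fun f => (memLp_vertexMeasure_iff hθ).1 (Lp.memLp f)
  have hL : ∀ f : Lp ℝ 2 (vertexMeasure θ),
      MemLp (laplacianFun w θ f) 2 (vertexMeasure θ) := fun f =>
    (memLp_vertexMeasure_iff hθ).2 (summable_laplacianFun_sq hθ hC (hsum f))
  have hmem : ∀ f : Lp ℝ 2 (vertexMeasure θ), f ∈ (-laplacian w θ hθ).domain := hL
  have hdom : (-laplacian w θ hθ).domain = ⊤ := eq_top_iff.2 fun f _ => hmem f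
  refine ⟨hdom, ?_⟩
  let A₀ : Lp ℝ 2 (vertexMeasure θ) →ₗ[ℝ] Lp ℝ 2 (vertexMeasure θ) :=
    (-laplacian w θ hθ).toFun ∘ₗ LinearMap.codRestrict _ LinearMap.id hmem
  have hA₀ : ∀ f, (A₀ f : G → ℝ) = -laplacianFun w θ f := by
    intro f
    have h1 : A₀ f = -(hL f).toLp (laplacianFun w θ f) := rfl
    rw [h1, eq_of_ae_eq_vertexMeasure hθ (Lp.coeFn_neg _), coeFn_toLp_vertexMeasure hθ]
  have hgreen : ∀ f g, HasSum
      (fun p : G × G => w.weight p.1 p.2 * ((f p.2 - f p.1) * (g p.2 - g p.1)))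
      (2 * inner ℝ (A₀ f) g) := by
    intro f g
    have h1 := (hasSum_inner_vertexMeasure hθ (A₀ f) g).neg
    rw [hA₀] at h1
    have h2 := hasSum_green hθ hC (hsum f) (hsum g) (a := -inner ℝ (A₀ f) g)
      (h1.congr_fun fun x => by simp)
    simpa using h2
  have hsymm : A₀.IsSymmetric := by
    intro f g
    have h1 := hgreen f g
    have h2 := hgreen g f
    have h3 := h1.unique (h2.congr_fun fun p => by ring)
    rw [real_inner_comm (A₀ g) f]
    linarith
  refine ⟨⟨A₀, hsymm.continuous⟩, fun f => rfl, hsymm, fun f => ?_⟩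
  exact (hgreen f f).congr_fun fun p => by rw [sq]

end EdgeWeights

/-! ### Test functions -/

section TestFunctions

variable {G : Type*} {Γ : SimpleGraph G} [Γ.LocallyFinite]
  {w : EdgeWeights Γ} {θ : G → ℝ} {C : ℝ}

/-- An upper bound for `(f y - f x)²` on each edge in terms of `f x ^ 2 + f y ^ 2` sums up to a
bound for the energy in terms of the norm. -/
theorem tsum_energy_le (hC : ∀ x, w.vertexWeight x ≤ C * θ x) {f : G → ℝ} {B : ℝ} (hB : 0 ≤ B)
    (hf : Summable fun x => θ x * f x ^ 2)
    (hedge : ∀ x y, Γ.Adj x y → (f y - f x) ^ 2 ≤ B * (f x ^ 2 + f y ^ 2)) :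
    ∑' p : G × G, w.weight p.1 p.2 * (f p.2 - f p.1) ^ 2 ≤
      2 * (B * C * ∑' x, θ x * f x ^ 2) := by
  have h1 := ((EdgeWeights.hasSum_weight_mul_fst_sq hC hf).add
    (EdgeWeights.hasSum_weight_mul_snd_sq hC hf)).mul_left B
  refine ((EdgeWeights.summable_energy hC hf).tsum_le_tsum (fun p => ?_) h1.summable).trans ?_
  · by_cases hp : Γ.Adj p.1 p.2
    · have := mul_le_mul_of_nonneg_left (hedge _ _ hp) (w.nonneg p.1 p.2)
      linarith
    · simp [w.weight_eq_zero hp]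
  · rw [h1.tsum_eq]
    have := mul_le_mul_of_nonneg_left (EdgeWeights.tsum_vertexWeight_mul_sq_le hC hf) hB
    linarith

variable [Countable G] [MeasurableSpace G] [DiscreteMeasurableSpace G]

/-- Test functions which escape to infinity after normalization bound the bottom of the essential
spectrum from above. -/
theorem lambdaEss_le_of_tendsto_zero (hθ : ∀ x, 0 < θ x)
    (hC : ∀ x, w.vertexWeight x ≤ C * θ x) {B : ℝ} (hB : 0 ≤ B) {f : ℕ → G → ℝ} {N : ℕ → ℝ}
    (hN : ∀ n, 0 < N n) (hf : ∀ n, HasSum (fun x => θ x * f n x ^ 2) (N n))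
    (hedge : ∀ n x y, Γ.Adj x y → (f n y - f n x) ^ 2 ≤ B * (f n x ^ 2 + f n y ^ 2))
    (hnull : ∀ x, Tendsto (fun n => f n x / √(N n)) atTop (𝓝 0)) :
    lambdaEss w θ hθ ≤ ((B * C : ℝ) : EReal) := by
  obtain ⟨hdom, A, hTA, hA, hen⟩ := EdgeWeights.exists_bounded_laplacian hθ hC
  have hsq : ∀ n, √(N n) ^ 2 = N n := fun n => Real.sq_sqrt (hN n).le
  have hmem : ∀ n, MemLp (fun x => f n x / √(N n)) 2 (vertexMeasure θ) := by
    intro n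
    rw [memLp_vertexMeasure_iff hθ]
    refine ((hf n).div_const (N n)).summable.congr fun x => ?_
    rw [div_pow, hsq, mul_div_assoc]
  set u : ℕ → Lp ℝ 2 (vertexMeasure θ) := fun n => (hmem n).toLp _ with hu
  have hux : ∀ n, (u n : G → ℝ) = fun x => f n x / √(N n) :=
    fun n => coeFn_toLp_vertexMeasure hθ (hmem n)
  have hone : ∀ n, HasSum (fun x => θ x * u n x ^ 2) 1 := by
    intro n
    have h1 := (hf n).div_const (N n)
    rw [div_self (hN n).ne'] at h1
    refine h1.congr_fun fun x => ?_
    rw [hux, div_pow, hsq, mul_div_assoc]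
  have hnorm : ∀ n, ‖u n‖ = 1 := by
    intro n
    have h1 := (hasSum_norm_sq_vertexMeasure hθ (u n)).unique (hone n)
    rwa [pow_eq_one_iff_of_nonneg (norm_nonneg _) two_ne_zero] at h1
  have hRayleigh : ∀ n, inner ℝ (A (u n)) (u n) ≤ B * C := by
    intro n
    have h1 := tsum_energy_le hC hB (hone n).summable (f := u n) fun x y hxy => by
      rw [hux, ← sub_div, div_pow, div_pow, div_pow, ← add_div, ← mul_div_assoc]
      exact div_le_div_of_nonneg_right (hedge n x y hxy) (sq_nonneg _)
    rw [(hen (u n)).tsum_eq, (hone n).tsum_eq] at h1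
    linarith
  classical
  -- The indicator functions of single vertices form a total set.
  have hδ : ∀ x : G, MemLp (Pi.single x (1 : ℝ)) 2 (vertexMeasure θ) := by
    intro x
    rw [memLp_vertexMeasure_iff hθ]
    refine summable_of_ne_finset_zero (s := {x}) fun y hy => ?_
    simp [Pi.single_eq_of_ne (Finset.notMem_singleton.1 hy)]
  have hδinner : ∀ (x : G) (g : Lp ℝ 2 (vertexMeasure θ)),
      inner ℝ ((hδ x).toLp _) g = θ x * g x := by
    intro x g
    refine (hasSum_inner_vertexMeasure hθ _ g).unique ?_
    rw [coeFn_toLp_vertexMeasure hθ]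
    convert hasSum_single x fun y hy => ?_ using 1
    · simp
    · simp [Pi.single_eq_of_ne hy]
  have hweak : ∀ g, Tendsto (fun n => inner ℝ g (u n)) atTop (𝓝 0) := by
    refine tendsto_inner_zero_of_total (C := 1) (fun n => (hnorm n).le)
      (s := Set.range fun x => (hδ x).toLp _) (fun g hg => ?_) ?_
    · refine Lp.ext ?_
      refine Filter.Eventually.of_forall fun x => ?_
      have h1 := hg _ ⟨x, rfl⟩
      rw [hδinner] at h1
      rw [eq_of_ae_eq_vertexMeasure hθ (Lp.coeFn_zero ℝ 2 (vertexMeasure θ))]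
      simpa [(hθ x).ne'] using h1
    · rintro _ ⟨x, rfl⟩
      simp_rw [hδinner, hux]
      simpa using (hnull x).const_mul (θ x)
  obtain ⟨l, hl, hlc⟩ := exists_mem_pmapEssSpectrum_le hdom hTA hA hnorm hweak hRayleigh
  exact (sInf_le (Set.mem_image_of_mem _ hl)).trans (EReal.coe_le_coe_iff.2 hlc)

/-- Indicator functions of single vertices show that `λ₀^ess ≤ C` if `π_x ≤ C θ_x`. -/
theorem lambdaEss_le_of_vertexWeight_le [Infinite G] (hθ : ∀ x, 0 < θ x)
    (hC : ∀ x, w.vertexWeight x ≤ C * θ x) : lambdaEss w θ hθ ≤ (C : EReal) := by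
  classical
  set v := Infinite.natEmbedding G
  have h := lambdaEss_le_of_tendsto_zero hθ hC zero_le_one
    (f := fun n => Pi.single (v n) 1) (N := fun n => θ (v n)) (fun n => hθ _) (fun n => ?_)
    (fun n x y hxy => ?_) fun x => ?_
  · rwa [one_mul] at h
  · convert hasSum_single (v n) fun y hy => ?_ using 1
    · simp
    · simp [Pi.single_eq_of_ne hy]
  · rcases eq_or_ne x (v n) with rfl | hx
    · simp [Pi.single_eq_of_ne hxy.ne']
    · simp [Pi.single_eq_of_ne hx]
  · refine tendsto_const_nhds.congr' ?_
    by_cases hx : ∃ k, v k = x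
    · obtain ⟨k, rfl⟩ := hx
      filter_upwards [eventually_gt_atTop k] with n hn
      rw [Pi.single_eq_of_ne (v.injective.ne hn.ne), zero_div]
    · refine Eventually.of_forall fun n => ?_
      have h0 : (Pi.single (v n) 1 : G → ℝ) x = 0 := Pi.single_eq_of_ne (fun h => hx ⟨n, h.symm⟩) _
      simp [h0]

end TestFunctions

/-- If `|φ x - φ y| ≤ s` then `f = exp φ` satisfies
`(f y - f x)² ≤ (1 - E)² / (1 + E²) (f x² + f y²)` with `E = exp s`. -/
theorem exp_sub_exp_sq_le {s a b : ℝ} (h : |a - b| ≤ s) :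
    (Real.exp b - Real.exp a) ^ 2 ≤
      (1 - Real.exp s) ^ 2 / (1 + Real.exp s ^ 2) * (Real.exp a ^ 2 + Real.exp b ^ 2) := by
  obtain ⟨h1, h2⟩ := abs_le.1 h
  have ha : Real.exp a ≤ Real.exp s * Real.exp b := by
    rw [← Real.exp_add, Real.exp_le_exp]; linarith
  have hb : Real.exp b ≤ Real.exp s * Real.exp a := by
    rw [← Real.exp_add, Real.exp_le_exp]; linarith
  rw [div_mul_eq_mul_div, le_div_iff₀ (by positivity)]
  have := mul_nonneg (sub_nonneg.2 ha) (sub_nonneg.2 hb)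
  linarith

/-! ### Volume growth -/

section VolumeGrowth

theorem IsMetric.nonneg {G : Type*} {ρ : G → G → ℝ} (hρ : IsMetric ρ) (x y : G) : 0 ≤ ρ x y := by
  have h1 := hρ.triangle x y x
  rw [hρ.symm y x, (hρ.eq_zero_iff x x).2 rfl] at h1
  linarith

theorem IsMetric.abs_sub_le {G : Type*} {ρ : G → G → ℝ} (hρ : IsMetric ρ) (z x y : G) :
    |ρ z x - ρ z y| ≤ ρ x y := by
  have h1 := hρ.triangle z x y
  have h2 := hρ.triangle z y x
  rw [hρ.symm y x] at h2
  exact abs_le.2 ⟨by linarith, by linarith⟩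

theorem exists_sum_gt_of_not_summable {ι : Type*} {θ : ι → ℝ} (hθ : ∀ x, 0 < θ x)
    (hsum : ¬ Summable θ) (b : ℝ) : ∃ S : Finset ι, b < ∑ x ∈ S, θ x := by
  by_contra! h
  exact hsum (summable_of_sum_le (fun x => (hθ x).le) h)

variable {G : Type*} [MeasurableSpace G] {θ : G → ℝ} {ρ : G → G → ℝ} {x₀ : G}

theorem inv_mul_coe_mul {r : ℝ} (hr : 0 < r) (c : ℝ) :
    ((1 / r : ℝ) : EReal) * ((c * r : ℝ) : EReal) = (c : EReal) := by
  rw [← EReal.coe_mul]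
  congr 1
  field_simp

theorem volumeGrowth_le_of_eventually {c : ℝ}
    (h : ∀ᶠ r in atTop, ballVolume θ ρ x₀ r ≤ ENNReal.ofReal (Real.exp (c * r))) :
    volumeGrowth θ ρ x₀ ≤ (c : EReal) := by
  refine limsup_le_of_le (by isBoundedDefault) ?_
  filter_upwards [h, eventually_gt_atTop 0] with r hr hr0
  rw [← inv_mul_coe_mul hr0 c]
  refine mul_le_mul_of_nonneg_left ?_ (EReal.coe_nonneg.2 (by positivity))
  rw [← Real.log_exp (c * r), ← ENNReal.log_ofReal_of_pos (Real.exp_pos _)]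
  exact ENNReal.log_monotone hr

theorem eventually_ballVolume_le {c : ℝ} (h : volumeGrowth θ ρ x₀ < (c : EReal)) :
    ∀ᶠ r in atTop, ballVolume θ ρ x₀ r ≤ ENNReal.ofReal (Real.exp (c * r)) := by
  filter_upwards [eventually_lt_of_limsup_lt h, eventually_gt_atTop 0] with r hr hr0
  by_contra! hlt
  have h1 := ENNReal.log_monotone hlt.le
  rw [ENNReal.log_ofReal_of_pos (Real.exp_pos _), Real.log_exp] at h1
  have h2 := mul_le_mul_of_nonneg_left h1
    (EReal.coe_nonneg.2 (show (0 : ℝ) ≤ 1 / r by positivity))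
  rw [inv_mul_coe_mul hr0] at h2
  exact absurd hr (not_lt.2 h2)

theorem ballVolume_mono : Monotone (ballVolume θ ρ x₀) :=
  fun _ _ h => measure_mono fun _ hx => le_trans hx h

variable [DiscreteMeasurableSpace G]

theorem ofReal_sum_le_ballVolume (hθ : ∀ x, 0 < θ x) {r : ℝ} {S : Finset G}
    (hS : ∀ x ∈ S, ρ x₀ x ≤ r) : ENNReal.ofReal (∑ x ∈ S, θ x) ≤ ballVolume θ ρ x₀ r := by
  rw [ballVolume, vertexMeasure_apply, ENNReal.ofReal_sum_of_nonneg fun x _ => (hθ x).le]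
  refine le_trans (Finset.sum_le_sum fun x hx => ?_) (ENNReal.sum_le_tsum S)
  rw [Set.indicator_of_mem (by exact hS x hx)]

/-- Infinite total mass forces nonnegative volume growth. -/
theorem volumeGrowth_nonneg (hθ : ∀ x, 0 < θ x) (hsum : ¬ Summable θ) :
    0 ≤ volumeGrowth θ ρ x₀ := by
  by_contra! hneg
  obtain ⟨S, hS⟩ := exists_sum_gt_of_not_summable hθ hsum 1
  obtain ⟨R, hR⟩ := (S.image (ρ x₀)).exists_le
  obtain ⟨r, hr, hRr⟩ := ((eventually_ballVolume_le (c := 0) (by simpa using hneg)).and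
    (eventually_ge_atTop R)).exists
  have h1 := ofReal_sum_le_ballVolume hθ (r := r) (S := S)
    fun x hx => (hR _ (Finset.mem_image_of_mem _ hx)).trans hRr
  have h2 := h1.trans hr
  rw [ENNReal.ofReal_le_ofReal_iff (Real.exp_pos _).le, zero_mul, Real.exp_zero] at h2
  linarith

/-- If `β` exceeds the volume growth, then `exp (-β ρ(x₀, ·))` has finite `θ`-mass. -/
theorem summable_mul_exp_neg (hθ : ∀ x, 0 < θ x) (hρ : ∀ x, 0 ≤ ρ x₀ x) {c β : ℝ} (hc : 0 ≤ c)
    (hcβ : c < β) (h : volumeGrowth θ ρ x₀ < (c : EReal)) :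
    Summable fun x => θ x * Real.exp (-β * ρ x₀ x) := by
  obtain ⟨R, hR⟩ := eventually_atTop.1 (eventually_ballVolume_le h)
  have hvol : ∀ n : ℕ, ballVolume θ ρ x₀ (n + 1) ≤
      ENNReal.ofReal (Real.exp (c * (|R| + 1)) * Real.exp (c * n)) := by
    intro n
    refine (ballVolume_mono (show (n + 1 : ℝ) ≤ |R| + 1 + n by linarith [abs_nonneg R])).trans ?_
    refine (hR _ (by linarith [le_abs_self R, (n.cast_nonneg : (0 : ℝ) ≤ n)])).trans_eq ?_
    rw [← Real.exp_add, mul_add]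
  -- The sum is bounded by that over the shells `n ≤ ρ(x₀, x) ≤ n + 1`.
  have hle : ∑' x, ENNReal.ofReal (θ x * Real.exp (-β * ρ x₀ x)) ≤
      ∑' n : ℕ, ENNReal.ofReal (Real.exp (-β * n)) * ballVolume θ ρ x₀ (n + 1) := by
    simp_rw [ballVolume, vertexMeasure_apply, ← ENNReal.tsum_mul_left]
    rw [ENNReal.tsum_comm]
    refine ENNReal.tsum_le_tsum fun x => ?_
    refine le_trans ?_ (ENNReal.le_tsum ⌊ρ x₀ x⌋₊)
    rw [Set.indicator_of_mem (by exact (Nat.lt_floor_add_one (ρ x₀ x)).le),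
      ENNReal.ofReal_mul (hθ x).le, mul_comm]
    gcongr ?_ * ENNReal.ofReal _
    refine ENNReal.ofReal_le_ofReal (Real.exp_le_exp.2 ?_)
    have := Nat.floor_le (hρ x)
    nlinarith
  have hgeom : Summable fun n : ℕ => Real.exp (-β * n) *
      (Real.exp (c * (|R| + 1)) * Real.exp (c * n)) := by
    have h1 : Summable fun n : ℕ => Real.exp (c - β) ^ n :=
      summable_geometric_of_lt_one (Real.exp_pos _).le
        (by rw [← Real.exp_zero]; exact Real.exp_lt_exp.2 (by linarith))
    refine (h1.mul_left (Real.exp (c * (|R| + 1)))).congr fun n => ?_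
    simp only [← Real.exp_nat_mul, ← Real.exp_add]
    congr 1
    ring
  have hfin : ∑' x, ENNReal.ofReal (θ x * Real.exp (-β * ρ x₀ x)) ≠ ⊤ := by
    refine ne_top_of_le_ne_top hgeom.tsum_ofReal_ne_top (hle.trans ?_)
    refine ENNReal.tsum_le_tsum fun n => ?_
    rw [ENNReal.ofReal_mul (Real.exp_pos _).le]
    gcongr
    exact hvol n
  refine (ENNReal.summable_toReal hfin).congr fun x => ?_
  rw [ENNReal.toReal_ofReal (mul_nonneg (hθ x).le (Real.exp_pos _).le)]

theorem InfiniteMassOnInfiniteConnected.not_summable [Infinite G] {Γ : SimpleGraph G}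
    (hΓ : Γ.Connected) (h : InfiniteMassOnInfiniteConnected Γ θ) :
    ¬ Summable θ := by
  intro hs
  have h1 := h Set.univ Set.infinite_univ ((SimpleGraph.induceUnivIso Γ).connected_iff.2 hΓ)
  rw [vertexMeasure_apply, Set.indicator_univ] at h1
  exact hs.tsum_ofReal_ne_top h1

theorem infiniteMass_of_le (Γ : SimpleGraph G) {a : ℝ} (ha : 0 < a) (hθ : ∀ x, a ≤ θ x) :
    InfiniteMassOnInfiniteConnected Γ θ := by
  intro U hU _
  rw [vertexMeasure_apply, ← tsum_subtype]
  have := hU.to_subtype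
  refine top_le_iff.1 ((ENNReal.tsum_const_eq_top_of_ne_zero (α := U)
    (ENNReal.ofReal_pos.2 ha).ne').symm.le.trans ?_)
  exact ENNReal.tsum_le_tsum fun x => ENNReal.ofReal_le_ofReal (hθ x)

end VolumeGrowth

/-! ### The upper bound -/

section UpperBound

theorem growthBound_eq_exp_sq (m M μ : ℝ) : growthBound m M μ =
    (1 - Real.exp (μ / 2 * M)) ^ 2 / (1 + Real.exp (μ / 2 * M) ^ 2) * (1 / m ^ 2) := by
  have h1 : Real.exp (M * μ) = Real.exp (μ / 2 * M) ^ 2 := by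
    rw [← Real.exp_nat_mul]; congr 1; push_cast; ring
  have h2 : (1 : ℝ) / 2 * M * μ = μ / 2 * M := by ring
  rw [growthBound, h1, h2, mul_comm]

theorem continuous_growthBound (m M : ℝ) : Continuous (growthBound m M) := by
  unfold growthBound
  refine continuous_const.mul (Continuous.div (by fun_prop) (by fun_prop) fun μ => ?_)
  positivity

/-- `m⁻² (1 - E)² / (1 + E²)` is increasing in `E = exp (M μ / 2) ≥ 1`. -/
theorem growthBound_mono (m : ℝ) {M μ ν : ℝ} (hM : 0 < M) (hμ : 0 ≤ μ) (h : μ ≤ ν) :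
    growthBound m M μ ≤ growthBound m M ν := by
  rw [growthBound_eq_exp_sq, growthBound_eq_exp_sq]
  refine mul_le_mul_of_nonneg_right ?_ (by positivity)
  set a := Real.exp (μ / 2 * M)
  set b := Real.exp (ν / 2 * M)
  have ha : 1 ≤ a := Real.one_le_exp (by positivity)
  have hab : a ≤ b := Real.exp_le_exp.2 (by nlinarith)
  rw [div_le_div_iff₀ (by positivity) (by positivity)]
  have hb : 1 ≤ a * b := by nlinarith
  nlinarith [mul_nonneg (sub_nonneg.2 hab) (sub_nonneg.2 hb)]

variable {G : Type*} {Γ : SimpleGraph G} [Γ.LocallyFinite] {w : EdgeWeights Γ} {θ : G → ℝ}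
  {ρ : G → G → ℝ}

theorem IsAdaptedMetric.vertexWeight_le (hθ : ∀ x, 0 < θ x) (hρ : IsAdaptedMetric w θ ρ) {m : ℝ}
    (hm : 0 < m) (hmρ : ∀ x y, Γ.Adj x y → m ≤ ρ x y) (x : G) :
    w.vertexWeight x ≤ 1 / m ^ 2 * θ x := by
  have h1 := hρ.sum_le_one x
  rw [one_div, inv_mul_le_iff₀ (hθ x), mul_one] at h1
  rw [one_div, le_inv_mul_iff₀ (by positivity), EdgeWeights.vertexWeight, Finset.mul_sum]
  refine le_trans (Finset.sum_le_sum fun y hy => ?_) h1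
  rw [mul_comm]
  refine mul_le_mul_of_nonneg_left ?_ (w.nonneg x y)
  exact pow_le_pow_left₀ hm.le (hmρ x y (by simpa using hy)) 2

variable [Countable G] [MeasurableSpace G] [DiscreteMeasurableSpace G]

/-- The estimate for any `ν` above the volume growth. The test functions are
`exp (ν / 2 * (j - |ρ(x₀, ·) - j|))`: they grow up to distance `j`, which makes their norms tend to
infinity, and then decay fast enough to be square summable. -/
theorem lambdaEss_le_growthBound_of_lt (hθ : ∀ x, 0 < θ x) (hsum : ¬ Summable θ)
    (hρ : IsAdaptedMetric w θ ρ) {m M : ℝ} (hm : 0 < m)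
    (hmM : ∀ x y, Γ.Adj x y → m ≤ ρ x y ∧ ρ x y ≤ M) (x₀ : G) {ν : ℝ}
    (hν : volumeGrowth θ ρ x₀ < (ν : EReal)) :
    lambdaEss w θ hθ ≤ (growthBound m M ν : EReal) := by
  obtain ⟨c, hc, hcν⟩ := EReal.exists_between_coe_real hν
  rw [EReal.coe_lt_coe_iff] at hcν
  have hc0 : 0 ≤ c := by
    have := ((volumeGrowth_nonneg hθ hsum).trans_lt hc).le
    exact_mod_cast this
  have hν0 : 0 < ν := by linarith
  set d : G → ℝ := ρ x₀
  have hd : ∀ x, 0 ≤ d x := hρ.isMetric.nonneg x₀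
  set f : ℕ → G → ℝ := fun j x => Real.exp (ν / 2 * (j - |d x - j|)) with hf
  have hfsq : ∀ j x, f j x ^ 2 = Real.exp (ν * (j - |d x - j|)) := by
    intro j x
    rw [hf, ← Real.exp_nat_mul]
    congr 1
    push_cast
    ring
  have hfs : ∀ j, Summable fun x => θ x * f j x ^ 2 := by
    intro j
    refine Summable.of_nonneg_of_le (fun x => mul_nonneg (hθ x).le (sq_nonneg _)) (fun x => ?_)
      ((summable_mul_exp_neg hθ hd hc0 hcν hc).mul_left (Real.exp (2 * ν * j)))
    rw [hfsq, mul_left_comm, ← Real.exp_add]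
    refine mul_le_mul_of_nonneg_left (Real.exp_le_exp.2 ?_) (hθ x).le
    nlinarith [le_abs_self (d x - j)]
  have hN : ∀ j, 0 < ∑' x, θ x * f j x ^ 2 := fun j =>
    (hfs j).tsum_pos (fun x => mul_nonneg (hθ x).le (sq_nonneg _)) x₀
      (mul_pos (hθ x₀) (pow_pos (Real.exp_pos _) 2))
  have hNtop : Tendsto (fun j => ∑' x, θ x * f j x ^ 2) atTop atTop := by
    refine tendsto_atTop.2 fun b => ?_
    obtain ⟨S, hS⟩ := exists_sum_gt_of_not_summable hθ hsum b
    obtain ⟨R, hR⟩ := (S.image d).exists_le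
    obtain ⟨k, hk⟩ := exists_nat_ge R
    filter_upwards [eventually_ge_atTop k] with j hj
    have hjR : R ≤ j := hk.trans (by exact_mod_cast hj)
    refine hS.le.trans (le_trans (Finset.sum_le_sum fun x hx => ?_)
      ((hfs j).sum_le_tsum S fun x _ => mul_nonneg (hθ x).le (sq_nonneg _)))
    have hdx : d x ≤ j := (hR _ (Finset.mem_image_of_mem _ hx)).trans hjR
    have h1 : 1 ≤ f j x ^ 2 := by
      rw [hfsq, abs_of_nonpos (by linarith)]
      exact Real.one_le_exp (mul_nonneg hν0.le (by linarith [hd x]))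
    nlinarith [hθ x]
  rw [growthBound_eq_exp_sq]
  refine lambdaEss_le_of_tendsto_zero hθ
    (hρ.vertexWeight_le hθ hm fun x y h => (hmM x y h).1) (by positivity) hN
    (fun j => (hfs j).hasSum) (fun j x y hxy => ?_) fun x => ?_
  · refine exp_sub_exp_sq_le ?_
    have h1 : |d x - d y| ≤ M := (hρ.isMetric.abs_sub_le x₀ x y).trans (hmM x y hxy).2
    have h2 : ν / 2 * ((j : ℝ) - |d x - j|) - ν / 2 * (j - |d y - j|) =
        ν / 2 * (|d y - j| - |d x - j|) := by ring
    rw [h2, abs_mul, abs_of_pos (by positivity : 0 < ν / 2)]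
    refine mul_le_mul_of_nonneg_left ?_ (by positivity)
    refine (abs_abs_sub_abs_le_abs_sub _ _).trans ?_
    rw [sub_sub_sub_cancel_right, abs_sub_comm]
    exact h1
  · have h1 : Tendsto (fun j => Real.exp (ν / 2 * d x) / √(∑' x, θ x * f j x ^ 2)) atTop (𝓝 0) :=
      Tendsto.div_atTop tendsto_const_nhds (Real.tendsto_sqrt_atTop.comp hNtop)
    refine squeeze_zero (fun j => by positivity) (fun j => ?_) h1
    refine div_le_div_of_nonneg_right (Real.exp_le_exp.2 ?_) (Real.sqrt_nonneg _)
    refine mul_le_mul_of_nonneg_left ?_ (by positivity)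
    linarith [neg_abs_le (d x - j)]

theorem lambdaEss_le_growthBound (hθ : ∀ x, 0 < θ x) (hsum : ¬ Summable θ)
    (hρ : IsAdaptedMetric w θ ρ) {m M : ℝ} (hm : 0 < m)
    (hmM : ∀ x y, Γ.Adj x y → m ≤ ρ x y ∧ ρ x y ≤ M) (x₀ : G) {μ : ℝ}
    (hμ : volumeGrowth θ ρ x₀ = (μ : EReal)) :
    lambdaEss w θ hθ ≤ (growthBound m M μ : EReal) := by
  have hlim : Tendsto (fun ν => (growthBound m M ν : EReal)) (𝓝[>] μ)
      (𝓝 (growthBound m M μ : EReal)) :=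
    ((continuous_coe_real_ereal.comp (continuous_growthBound m M)).tendsto μ).mono_left
      nhdsWithin_le_nhds
  refine ge_of_tendsto hlim ?_
  filter_upwards [self_mem_nhdsWithin] with ν hν
  exact lambdaEss_le_growthBound_of_lt hθ hsum hρ hm hmM x₀
    (by rw [hμ]; exact EReal.coe_lt_coe_iff.2 hν)

end UpperBound

/-! ### The lower bound by a positive supersolution -/

section Supersolution

variable {G : Type*} {Γ : SimpleGraph G} [Γ.LocallyFinite] {w : EdgeWeights Γ} {θ : G → ℝ} {C : ℝ}

/-- If a positive function `h` satisfies `-𝓛_θ h ≥ c h`, then the energy of `f` is at least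
`c ‖f‖²`, because `2 f(x) f(y) ≤ (h y / h x) f(x)² + (h x / h y) f(y)²`. -/
theorem le_energy_of_supersolution (hC : ∀ x, w.vertexWeight x ≤ C * θ x) {h : G → ℝ}
    (hpos : ∀ x, 0 < h x) {D : ℝ} (hD : ∀ x y, Γ.Adj x y → h y / h x ≤ D) {c : ℝ}
    (hc : ∀ x, c * θ x ≤ ∑ y ∈ Γ.neighborFinset x, w.weight x y * (1 - h y / h x)) {f : G → ℝ}
    (hf : Summable fun x => θ x * f x ^ 2) :
    2 * (c * ∑' x, θ x * f x ^ 2) ≤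
      ∑' p : G × G, w.weight p.1 p.2 * (f p.2 - f p.1) ^ 2 := by
  set a : G × G → ℝ := fun p => w.weight p.1 p.2 * (1 - h p.2 / h p.1) * f p.1 ^ 2 with ha
  have hs : Summable a := by
    refine Summable.of_norm_bounded
      (((EdgeWeights.hasSum_weight_mul_fst_sq hC hf).summable).mul_left (1 + |D|)) fun p => ?_
    rw [ha, Real.norm_eq_abs, abs_mul, abs_mul, abs_of_nonneg (w.nonneg _ _),
      abs_of_nonneg (sq_nonneg (f p.1))]
    by_cases hp : Γ.Adj p.1 p.2
    · have h1 : 0 < h p.2 / h p.1 := div_pos (hpos _) (hpos _)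
      have h2 : |1 - h p.2 / h p.1| ≤ 1 + |D| := by
        rw [abs_le]
        constructor <;> linarith [hD _ _ hp, le_abs_self D, abs_nonneg D]
      have := mul_le_mul_of_nonneg_left h2
        (mul_nonneg (w.nonneg p.1 p.2) (sq_nonneg (f p.1)))
      linarith
    · simp [w.weight_eq_zero hp]
  have hfib : ∀ x, HasSum (fun y => a (x, y))
      ((∑ y ∈ Γ.neighborFinset x, w.weight x y * (1 - h y / h x)) * f x ^ 2) := fun x =>
    (w.hasSum_weight_mul (fun y => 1 - h y / h x) x).mul_right _
  have h1 := hs.hasSum.prod_fiberwise hfib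
  have h2 : c * ∑' x, θ x * f x ^ 2 ≤ ∑' p, a p := by
    rw [← h1.tsum_eq, ← tsum_mul_left]
    refine (hf.mul_left c).tsum_le_tsum (fun x => ?_) h1.summable
    rw [← mul_assoc]
    exact mul_le_mul_of_nonneg_right (hc x) (sq_nonneg _)
  have h3 := hs.hasSum.add ((Equiv.prodComm G G).hasSum_iff.2 hs.hasSum)
  have h4 : ∑' p, a p + ∑' p, a p ≤ ∑' p : G × G, w.weight p.1 p.2 * (f p.2 - f p.1) ^ 2 := by
    rw [← h3.tsum_eq]
    refine h3.summable.tsum_le_tsum (fun p => ?_) (EdgeWeights.summable_energy hC hf)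
    simp only [ha, Function.comp_apply, Equiv.prodComm_apply, Prod.fst_swap, Prod.snd_swap,
      w.symm p.2 p.1]
    have hx := hpos p.1
    have hy := hpos p.2
    have h5 : 0 ≤ h p.2 / h p.1 * f p.1 ^ 2 + h p.1 / h p.2 * f p.2 ^ 2 - 2 * f p.1 * f p.2 := by
      have : h p.2 / h p.1 * f p.1 ^ 2 + h p.1 / h p.2 * f p.2 ^ 2 - 2 * f p.1 * f p.2 =
          (h p.2 * f p.1 - h p.1 * f p.2) ^ 2 / (h p.1 * h p.2) := by
        field_simp
        ring
      rw [this]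
      positivity
    have := mul_nonneg (w.nonneg p.1 p.2) h5
    linarith
  linarith

theorem le_lambdaEss_of_supersolution [Countable G] [MeasurableSpace G]
    [DiscreteMeasurableSpace G] (hθ : ∀ x, 0 < θ x) (hC : ∀ x, w.vertexWeight x ≤ C * θ x)
    {h : G → ℝ} (hpos : ∀ x, 0 < h x) {D : ℝ} (hD : ∀ x y, Γ.Adj x y → h y / h x ≤ D) {c : ℝ}
    (hc : ∀ x, c * θ x ≤ ∑ y ∈ Γ.neighborFinset x, w.weight x y * (1 - h y / h x)) :
    (c : EReal) ≤ lambdaEss w θ hθ := by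
  obtain ⟨hdom, A, hTA, -, hen⟩ := EdgeWeights.exists_bounded_laplacian hθ hC
  refine le_sInf ?_
  rintro _ ⟨z, hz, rfl⟩
  refine EReal.coe_le_coe_iff.2 (le_of_mem_pmapSpectrum hdom hTA (fun f => ?_) hz.1)
  have hsum := hasSum_norm_sq_vertexMeasure hθ f
  have := le_energy_of_supersolution hC hpos hD hc hsum.summable
  rw [hsum.tsum_eq, (hen f).tsum_eq] at this
  linarith

end Supersolution

/-! ### The graph metric -/

section GraphMetric

variable {G : Type*} {Γ : SimpleGraph G}

theorem isMetric_const_mul_graphMetric (hΓ : Γ.Connected) {s : ℝ} (hs : 0 < s) :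
    IsMetric fun x y => s * graphMetric Γ x y where
  eq_zero_iff x y := by simp [graphMetric, hs.ne', hΓ.dist_eq_zero_iff]
  symm x y := by simp [graphMetric, SimpleGraph.dist_comm]
  triangle x y z := by
    rw [← mul_add]
    refine mul_le_mul_of_nonneg_left ?_ hs.le
    simp only [graphMetric]
    exact_mod_cast hΓ.dist_triangle

theorem graphMetric_eq_one {x y : G} (h : Γ.Adj x y) : graphMetric Γ x y = 1 := by
  simp [graphMetric, SimpleGraph.dist_eq_one_iff_adj.2 h]

/-- In a connected graph, every vertex other than the root has a neighbour closer to the root. -/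
theorem exists_adj_dist_eq (hΓ : Γ.Connected) {x₀ x : G} {n : ℕ} (h : Γ.dist x₀ x = n + 1) :
    ∃ y, Γ.Adj x y ∧ Γ.dist x₀ y = n := by
  obtain ⟨p, hp⟩ := hΓ.exists_walk_length_eq_dist x x₀
  rw [SimpleGraph.dist_comm, h] at hp
  cases p with
  | nil => simp at hp
  | @cons _ y _ hxy p =>
    refine ⟨y, hxy, ?_⟩
    rw [SimpleGraph.Walk.length_cons] at hp
    have h1 : Γ.dist x₀ y ≤ n := by
      rw [SimpleGraph.dist_comm]
      exact (SimpleGraph.dist_le p).trans (by omega)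
    have h2 := hΓ.dist_triangle (u := x₀) (v := y) (w := x)
    rw [SimpleGraph.dist_eq_one_iff_adj.2 hxy.symm] at h2
    omega

variable [Γ.LocallyFinite]

theorem vertexWeight_standard (x : G) :
    (EdgeWeights.standard Γ).vertexWeight x = Γ.degree x := by
  rw [EdgeWeights.vertexWeight, Finset.sum_congr rfl (g := fun _ => (1 : ℝ))]
  · simp
  · intro y hy
    simpa [EdgeWeights.standard] using hy

theorem isAdaptedMetric_const_mul_graphMetric (hΓ : Γ.Connected) {θ : G → ℝ}
    (hθ : ∀ x, 0 < θ x) {s : ℝ} (hs : 0 < s) (hsθ : ∀ x, Γ.degree x * s ^ 2 ≤ θ x) :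
    IsAdaptedMetric (EdgeWeights.standard Γ) θ fun x y => s * graphMetric Γ x y where
  isMetric := isMetric_const_mul_graphMetric hΓ hs
  sum_le_one x := by
    rw [one_div, inv_mul_le_iff₀ (hθ x), mul_one]
    refine le_trans (le_of_eq ?_) (hsθ x)
    rw [← vertexWeight_standard, EdgeWeights.vertexWeight, Finset.sum_mul]
    refine Finset.sum_congr rfl fun y hy => ?_
    rw [graphMetric_eq_one (by simpa using hy), mul_one]
  bounded := ⟨s, hs, fun x y h => by rw [graphMetric_eq_one h, mul_one]⟩

/-- An infinite connected regular graph has degree at least two. -/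
theorem two_le_of_isRegularOfDegree [Infinite G] (hΓ : Γ.Connected) {k : ℕ}
    (hk : Γ.IsRegularOfDegree k) : 2 ≤ k := by
  classical
  by_contra! hlt
  obtain ⟨x⟩ := hΓ.nonempty
  -- If all degrees are at most one, then no vertex has distance two from `x`.
  have hdist : ∀ y, Γ.dist x y ≤ 1 := by
    intro y
    induction hn : Γ.dist x y using Nat.strong_induction_on generalizing y with
    | _ n ih =>
      by_contra! h1
      obtain ⟨m, rfl⟩ : ∃ m, n = m + 1 := ⟨n - 1, by omega⟩
      obtain ⟨z, hyz, hz⟩ := exists_adj_dist_eq hΓ hn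
      have hm := ih m (by omega) z hz
      obtain ⟨u, hzu, hu⟩ := exists_adj_dist_eq hΓ (n := m - 1) (by omega : Γ.dist x z = m - 1 + 1)
      have huy : u ≠ y := by rintro rfl; omega
      have h2 : ({u, y} : Finset G).card ≤ Γ.degree z := by
        refine Finset.card_le_card fun v hv => ?_
        rcases Finset.mem_insert.1 hv with rfl | hv
        · simpa using hzu
        · rw [Finset.mem_singleton.1 hv]; simpa using hyz.symm
      rw [Finset.card_pair huy, hk z] at h2
      omega
  refine Infinite.not_finite (α := G) (Set.finite_univ_iff.1
    ((insert x (Γ.neighborFinset x)).finite_toSet.subset fun y _ => ?_))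
  rcases Nat.le_one_iff_eq_zero_or_eq_one.1 (hdist y) with h | h
  · simp [hΓ.dist_eq_zero_iff.1 h]
  · simp [SimpleGraph.dist_eq_one_iff_adj.1 h]

end GraphMetric

/-! ### Volume growth of regular graphs -/

section RegularGraph

variable {G : Type*} {Γ : SimpleGraph G} [Γ.LocallyFinite]

/-- A sphere of radius `n` in a `(q + 1)`-regular graph has at most `(q + 1) q ^ n` elements. -/
theorem exists_finset_sphere (hΓ : Γ.Connected) {q : ℕ} (hq : 1 ≤ q)
    (hreg : Γ.IsRegularOfDegree (q + 1)) (x₀ : G) (n : ℕ) :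
    ∃ S : Finset G, (∀ x, x ∈ S ↔ Γ.dist x₀ x = n) ∧ S.card ≤ (q + 1) * q ^ n := by
  classical
  induction n with
  | zero =>
    refine ⟨{x₀}, fun x => ?_, by simp⟩
    rw [Finset.mem_singleton, hΓ.dist_eq_zero_iff, eq_comm]
  | succ n ih =>
    obtain ⟨S, hS, hcard⟩ := ih
    refine ⟨S.biUnion fun x => (Γ.neighborFinset x).filter fun y => Γ.dist x₀ y = n + 1,
      fun y => ?_, ?_⟩
    · simp only [Finset.mem_biUnion, Finset.mem_filter, SimpleGraph.mem_neighborFinset]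
      constructor
      · rintro ⟨x, -, -, hy⟩
        exact hy
      · intro hy
        obtain ⟨x, hyx, hx⟩ := exists_adj_dist_eq hΓ hy
        exact ⟨x, (hS x).2 hx, hyx.symm, hy⟩
    · rcases Nat.eq_zero_or_pos n with rfl | hn
      · have h1 : S.card ≤ 1 := Finset.card_le_one.2 fun a ha b hb => by
          rw [hS, hΓ.dist_eq_zero_iff] at ha hb
          rw [← ha, ← hb]
        refine (Finset.card_biUnion_le_card_mul S _ (q + 1) fun x _ => ?_).trans ?_
        · rw [← hreg x]
          exact Finset.card_filter_le _ _
        · calc S.card * (q + 1) ≤ 1 * (q + 1) := Nat.mul_le_mul_right _ h1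
            _ ≤ (q + 1) * q ^ (0 + 1) := by
              rw [one_mul, zero_add, pow_one]
              exact Nat.le_mul_of_pos_right _ hq
      · refine (Finset.card_biUnion_le_card_mul S _ q fun x hx => ?_).trans ?_
        · -- One of the `q + 1` neighbours of `x` is closer to the root.
          obtain ⟨m, rfl⟩ : ∃ m, n = m + 1 := ⟨n - 1, by omega⟩
          obtain ⟨z, hxz, hz⟩ := exists_adj_dist_eq hΓ ((hS x).1 hx)
          have hzN : z ∈ Γ.neighborFinset x := by simpa using hxz
          have h1 : ((Γ.neighborFinset x).erase z).card = q := by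
            rw [Finset.card_erase_of_mem hzN, SimpleGraph.card_neighborFinset_eq_degree, hreg x]
            rfl
          rw [← h1]
          refine Finset.card_le_card fun y hy => ?_
          rw [Finset.mem_filter] at hy
          refine Finset.mem_erase.2 ⟨?_, hy.1⟩
          rintro rfl
          omega
        · rw [pow_succ, ← mul_assoc]
          exact Nat.mul_le_mul_right q hcard

theorem exists_finset_ball (hΓ : Γ.Connected) {q : ℕ} (hq : 1 ≤ q)
    (hreg : Γ.IsRegularOfDegree (q + 1)) (x₀ : G) (n : ℕ) :
    ∃ S : Finset G, (∀ x, Γ.dist x₀ x ≤ n → x ∈ S) ∧ S.card ≤ (n + 1) * ((q + 1) * q ^ n) := by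
  classical
  choose S hS hcard using exists_finset_sphere hΓ hq hreg x₀
  refine ⟨(Finset.range (n + 1)).biUnion S, fun x hx => ?_, ?_⟩
  · exact Finset.mem_biUnion.2 ⟨_, Finset.mem_range.2 (by omega), (hS _ x).2 rfl⟩
  · refine (Finset.card_biUnion_le_card_mul _ _ ((q + 1) * q ^ n) fun i hi => ?_).trans (by simp)
    refine (hcard i).trans (Nat.mul_le_mul_left _ (Nat.pow_le_pow_right hq ?_))
    have := Finset.mem_range.1 hi
    omega

/-- The volume growth of a `(q + 1)`-regular graph is at most that of the regular tree. -/
theorem volumeGrowth_le_log [MeasurableSpace G] [DiscreteMeasurableSpace G] (hΓ : Γ.Connected)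
    {q : ℕ} (hq : 1 ≤ q) (hreg : Γ.IsRegularOfDegree (q + 1)) {θ : G → ℝ} {t : ℝ} (ht : 0 < t)
    (hθ : ∀ x, θ x = t) {s : ℝ} (hs : 0 < s) (x₀ : G) :
    volumeGrowth θ (fun x y => s * graphMetric Γ x y) x₀ ≤ ((Real.log q / s : ℝ) : EReal) := by
  have hq0 : (0 : ℝ) < q := by exact_mod_cast hq
  have hlog : 0 ≤ Real.log q := Real.log_nonneg (by exact_mod_cast hq)
  refine EReal.le_of_forall_lt_iff_le.1 fun c hc => ?_
  rw [EReal.coe_lt_coe_iff] at hc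
  refine volumeGrowth_le_of_eventually ?_
  have hlin : ∀ᶠ r : ℝ in atTop,
      t * (q + 1) * (r / s + 1) ≤ Real.exp ((c - Real.log q / s) * r) := by
    have h1 := isLittleO_pow_exp_pos_mul_atTop 1 (sub_pos.2 hc)
    have h0 := isLittleO_pow_exp_pos_mul_atTop 0 (sub_pos.2 hc)
    have h2 := (h1.const_mul_left (t * (q + 1) / s)).add (h0.const_mul_left (t * (q + 1)))
    filter_upwards [h2.bound one_pos] with r hr
    rw [one_mul, Real.norm_eq_abs, Real.norm_eq_abs, abs_of_pos (Real.exp_pos _)] at hr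
    refine le_trans (le_of_eq ?_) ((le_abs_self _).trans hr)
    ring
  filter_upwards [hlin, eventually_ge_atTop 0] with r hr hr0
  set n := ⌊r / s⌋₊
  have hn : (n : ℝ) ≤ r / s := Nat.floor_le (by positivity)
  obtain ⟨S, hS, hcard⟩ := exists_finset_ball hΓ hq hreg x₀ n
  have hvol : ballVolume θ (fun x y => s * graphMetric Γ x y) x₀ r ≤
      ENNReal.ofReal (S.card * t) := by
    rw [ballVolume, vertexMeasure_apply, tsum_eq_sum (s := S)]
    · rw [← nsmul_eq_mul, ← Finset.sum_const,
        ENNReal.ofReal_sum_of_nonneg fun _ _ => ht.le]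
      refine Finset.sum_le_sum fun x _ => ?_
      rw [← hθ x]
      exact Set.indicator_le_self _ _ _
    · intro x hx
      refine Set.indicator_of_notMem (fun h => hx (hS x (Nat.le_floor ?_))) _
      rw [le_div_iff₀ hs, mul_comm]
      exact h
  refine hvol.trans (ENNReal.ofReal_le_ofReal ?_)
  have hpow : (q : ℝ) ^ n ≤ Real.exp (Real.log q / s * r) := by
    rw [← Real.exp_log hq0, ← Real.exp_nat_mul, Real.exp_log hq0]
    refine Real.exp_le_exp.2 ?_
    calc n * Real.log q ≤ r / s * Real.log q := by gcongr
      _ = _ := by ring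
  have hcard' : (S.card : ℝ) ≤ (n + 1) * ((q + 1) * (q : ℝ) ^ n) := by exact_mod_cast hcard
  calc S.card * t ≤ ((n + 1) * ((q + 1) * (q : ℝ) ^ n)) * t := by gcongr
    _ ≤ ((r / s + 1) * ((q + 1) * Real.exp (Real.log q / s * r))) * t := by gcongr
    _ = t * (q + 1) * (r / s + 1) * Real.exp (Real.log q / s * r) := by ring
    _ ≤ Real.exp ((c - Real.log q / s) * r) * Real.exp (Real.log q / s * r) := by gcongr
    _ = Real.exp (c * r) := by
        rw [← Real.exp_add]
        congr 1
        ring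

end RegularGraph

/-! ### Regular trees -/

section RegularTree

variable {G : Type*} {Γ : SimpleGraph G}

/-- In a tree, at most one neighbour of a vertex is closer to the root. -/
theorem SimpleGraph.IsTree.eq_of_adj_of_dist_eq (hΓ : Γ.IsTree) {x₀ x y z : G} (hxy : Γ.Adj x y)
    (hxz : Γ.Adj x z) (hy : Γ.dist x₀ x = Γ.dist x₀ y + 1) (hz : Γ.dist x₀ x = Γ.dist x₀ z + 1) :
    y = z := by
  have key : ∀ y, Γ.Adj x y → Γ.dist x₀ x = Γ.dist x₀ y + 1 →
      ∃ p : Γ.Walk x₀ x, p.IsPath ∧ y = p.penultimate := by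
    intro y hxy hy
    obtain ⟨p, hp⟩ := hΓ.connected.exists_walk_length_eq_dist x₀ y
    refine ⟨p.concat hxy.symm, ?_, by simp⟩
    refine SimpleGraph.Walk.isPath_of_length_eq_dist _ ?_
    rw [SimpleGraph.Walk.length_concat, hp, hy]
  obtain ⟨p, hp, rfl⟩ := key y hxy hy
  obtain ⟨p', hp', rfl⟩ := key z hxz hz
  rw [(hΓ.existsUnique_path x₀ x).unique hp hp']

variable [Γ.LocallyFinite]

/-- On the `(q + 1)`-regular tree, `h = √q ^ (-d(x₀, ·))` satisfies `∑_{y ∼ x} h y ≤ 2 √q h x`,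
with equality away from the root. -/
theorem sum_ratio_le (hΓ : Γ.IsTree) {q : ℕ} (hq : 1 ≤ q) (hreg : Γ.IsRegularOfDegree (q + 1))
    (x₀ x : G) :
    ∑ y ∈ Γ.neighborFinset x, (√q)⁻¹ ^ Γ.dist x₀ y / (√q)⁻¹ ^ Γ.dist x₀ x ≤ 2 * √q := by
  classical
  have hq1 : (1 : ℝ) ≤ q := by exact_mod_cast hq
  have hs0 : 0 < √(q : ℝ) := Real.sqrt_pos.2 (by linarith)
  have hsq : √(q : ℝ) * √q = q := Real.mul_self_sqrt (by linarith)
  have hfar : ∀ y, Γ.dist x₀ y = Γ.dist x₀ x + 1 →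
      (√q)⁻¹ ^ Γ.dist x₀ y / (√q)⁻¹ ^ Γ.dist x₀ x = (√(q : ℝ))⁻¹ := by
    intro y hy
    rw [hy, pow_succ]
    field_simp
  by_cases hpar : ∃ p, Γ.Adj x p ∧ Γ.dist x₀ x = Γ.dist x₀ p + 1
  · obtain ⟨p, hxp, hp⟩ := hpar
    have hpN : p ∈ Γ.neighborFinset x := by simpa using hxp
    rw [← Finset.add_sum_erase _ _ hpN, Finset.sum_congr rfl (g := fun _ => (√(q : ℝ))⁻¹)]
    · rw [Finset.sum_const, Finset.card_erase_of_mem hpN,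
        SimpleGraph.card_neighborFinset_eq_degree, hreg x, Nat.add_sub_cancel, hp, pow_succ,
        nsmul_eq_mul]
      have h1 : (√(q : ℝ))⁻¹ ^ Γ.dist x₀ p / ((√(q : ℝ))⁻¹ ^ Γ.dist x₀ p * (√(q : ℝ))⁻¹) = √q := by
        field_simp
      have h2 : (q : ℝ) * (√(q : ℝ))⁻¹ = √q := by
        rw [← div_eq_mul_inv, div_eq_iff hs0.ne', hsq]
      rw [h1, h2, two_mul]
    · intro y hy
      have hxy : Γ.Adj x y := by simpa using Finset.mem_of_mem_erase hy
      refine hfar y ?_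
      rcases hΓ.dist_eq_dist_add_one_of_adj x₀ hxy with h | h
      · exact absurd (hΓ.eq_of_adj_of_dist_eq hxy hxp h hp) (Finset.ne_of_mem_erase hy)
      · exact h
  · rw [Finset.sum_congr rfl (g := fun _ => (√(q : ℝ))⁻¹)]
    · rw [Finset.sum_const, SimpleGraph.card_neighborFinset_eq_degree, hreg x, nsmul_eq_mul,
        ← div_eq_mul_inv, div_le_iff₀ hs0, mul_assoc, hsq]
      push_cast
      linarith
    · intro y hy
      have hxy : Γ.Adj x y := by simpa using hy
      refine hfar y ?_
      rcases hΓ.dist_eq_dist_add_one_of_adj x₀ hxy with h | h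
      · exact absurd ⟨y, hxy, h⟩ hpar
      · exact h

theorem vertexWeight_standard_of_isRegular {k : ℕ} (hreg : Γ.IsRegularOfDegree k) (x : G) :
    (EdgeWeights.standard Γ).vertexWeight x = k := by
  rw [vertexWeight_standard, hreg x]

variable [Countable G] [MeasurableSpace G] [DiscreteMeasurableSpace G]

/-- The bottom of the spectrum of the `(q + 1)`-regular tree is at least `(q + 1 - 2 √q) / t` for
vertex weights equal to `t`. -/
theorem le_lambdaEss_regularTree (hΓ : Γ.IsTree) {q : ℕ} (hq : 1 ≤ q)
    (hreg : Γ.IsRegularOfDegree (q + 1)) {θ : G → ℝ} (hθ : ∀ x, 0 < θ x) {t : ℝ} (ht : 0 < t)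
    (hθt : ∀ x, θ x = t) (x₀ : G) :
    (((q + 1 - 2 * √q) / t : ℝ) : EReal) ≤ lambdaEss (EdgeWeights.standard Γ) θ hθ := by
  have hs1 : 1 ≤ √(q : ℝ) := Real.one_le_sqrt.2 (by exact_mod_cast hq)
  have hs0 : 0 < √(q : ℝ) := by linarith
  have hadj : ∀ x, ∀ y ∈ Γ.neighborFinset x, (EdgeWeights.standard Γ).weight x y = 1 :=
    fun x y hy => by simpa [EdgeWeights.standard] using hy
  refine le_lambdaEss_of_supersolution (C := (q + 1) / t)
    (h := fun x => (√(q : ℝ))⁻¹ ^ Γ.dist x₀ x) (D := 2 * √q) hθ (fun x => ?_)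
    (fun x => by positivity) (fun x y hxy => ?_) fun x => ?_
  · rw [vertexWeight_standard_of_isRegular hreg, hθt, div_mul_cancel₀ _ ht.ne']
    push_cast
    rfl
  · refine le_trans ?_ (sum_ratio_le hΓ hq hreg x₀ x)
    exact Finset.single_le_sum
      (f := fun y => (√(q : ℝ))⁻¹ ^ Γ.dist x₀ y / (√(q : ℝ))⁻¹ ^ Γ.dist x₀ x)
      (fun z _ => by positivity) (by simpa using hxy)
  · rw [hθt, div_mul_cancel₀ _ ht.ne',
      Finset.sum_congr rfl fun y hy => by rw [hadj x y hy, one_mul],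
      Finset.sum_sub_distrib, Finset.sum_const, SimpleGraph.card_neighborFinset_eq_degree, hreg x,
      nsmul_eq_mul, mul_one]
    have := sum_ratio_le hΓ hq hreg x₀ x
    push_cast
    linarith

/-- Equality on regular trees for constant vertex weights `t` and the multiple `s d` of the graph
metric with `k s² = t`. The volume growth need not be computed exactly: the upper bound
`log (k - 1) / s` for it makes the upper estimate of the bottom of the essential spectrum meet the
lower one. -/
theorem exists_volumeGrowth_eq_and_lambdaEss_eq [Infinite G] (hΓ : Γ.IsTree) {k : ℕ}
    (hreg : Γ.IsRegularOfDegree k) {θ : G → ℝ} (hθ : ∀ x, 0 < θ x) {t s : ℝ} (ht : 0 < t)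
    (hs : 0 < s) (hθt : ∀ x, θ x = t) (hst : k * s ^ 2 = t) (x₀ : G) :
    ∃ μ : ℝ, volumeGrowth θ (fun x y => s * graphMetric Γ x y) x₀ = (μ : EReal) ∧
      lambdaEss (EdgeWeights.standard Γ) θ hθ = (growthBound s s μ : EReal) := by
  have hk := two_le_of_isRegularOfDegree hΓ.connected hreg
  obtain ⟨q, rfl⟩ : ∃ q, k = q + 1 := ⟨k - 1, by omega⟩
  have hq : 1 ≤ q := by omega
  have hq0 : (0 : ℝ) < q := by exact_mod_cast hq
  have hsum : ¬ Summable θ :=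
    (infiniteMass_of_le Γ ht fun x => (hθt x).ge).not_summable hΓ.connected
  have hup := volumeGrowth_le_log hΓ.connected hq hreg ht hθt hs x₀
  have hlow : 0 ≤ volumeGrowth θ (fun x y => s * graphMetric Γ x y) x₀ :=
    volumeGrowth_nonneg hθ hsum
  obtain ⟨μ, hμ⟩ : ∃ μ : ℝ, volumeGrowth θ (fun x y => s * graphMetric Γ x y) x₀ = (μ : EReal) :=
    ⟨_, (EReal.coe_toReal (ne_top_of_le_ne_top (EReal.coe_ne_top _) hup)
      (ne_bot_of_le_ne_bot (by simp) hlow)).symm⟩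
  rw [hμ] at hup hlow
  have hμ0 : 0 ≤ μ := by exact_mod_cast hlow
  have hμq : μ ≤ Real.log q / s := by exact_mod_cast hup
  refine ⟨μ, hμ, le_antisymm ?_ ?_⟩
  · refine lambdaEss_le_growthBound hθ hsum (isAdaptedMetric_const_mul_graphMetric hΓ.connected hθ
      hs fun x => ?_) hs (fun x y hxy => ?_) x₀ hμ
    · rw [hθt, hreg x, hst]
    · rw [graphMetric_eq_one hxy, mul_one]
      exact ⟨le_rfl, le_rfl⟩
  · refine le_trans (EReal.coe_le_coe_iff.2 ?_) (le_lambdaEss_regularTree hΓ hq hreg hθ ht hθt x₀)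
    refine (growthBound_mono s hs hμ0 hμq).trans_eq ?_
    have hE : Real.exp (Real.log q / s / 2 * s) = √q := by
      rw [Real.sqrt_eq_rpow, Real.rpow_def_of_pos hq0]
      congr 1
      field_simp
    have hsq : √(q : ℝ) ^ 2 = q := Real.sq_sqrt hq0.le
    rw [growthBound_eq_exp_sq, hE, ← hst, sub_sq, hsq]
    push_cast
    field_simp
    ring

end RegularTree

theorem growthBound_one_one (μ : ℝ) :
    growthBound 1 1 μ = 1 - 2 * Real.exp (μ / 2) / (1 + Real.exp μ) := by
  have h : Real.exp μ = Real.exp (μ / 2) ^ 2 := by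
    rw [← Real.exp_nat_mul]; congr 1; push_cast; ring
  rw [growthBound_eq_exp_sq, mul_one, h]
  field_simp
  ring

theorem theorem3 {G : Type*} [Countable G] [Infinite G]
    [MeasurableSpace G] [DiscreteMeasurableSpace G]
    (Γ : SimpleGraph G) [Γ.LocallyFinite] (hΓ : Γ.Connected) :
    -- the estimate, for finite and for infinite volume growth
    (∀ (w : EdgeWeights Γ) (θ : G → ℝ) (hθ : ∀ x, 0 < θ x),
      InfiniteMassOnInfiniteConnected Γ θ →
      ∀ ρ : G → G → ℝ, IsAdaptedMetric w θ ρ →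
      ∀ m M : ℝ, 0 < m → 0 < M →
      (∀ x y, Γ.Adj x y → m ≤ ρ x y ∧ ρ x y ≤ M) →
      ∀ x₀ : G,
        (∀ μ : ℝ, volumeGrowth θ ρ x₀ = (μ : EReal) →
          lambdaEss w θ hθ ≤ (growthBound m M μ : EReal)) ∧
        (volumeGrowth θ ρ x₀ = ⊤ →
          lambdaEss w θ hθ ≤ ((1 / m ^ 2 : ℝ) : EReal))) ∧
    -- Fujiwara's bound: standard weights, normalized Laplacian, graph metric, `m = M = 1`
    (InfiniteMassOnInfiniteConnected Γ (EdgeWeights.standard Γ).vertexWeight ∧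
      IsAdaptedMetric (EdgeWeights.standard Γ) (EdgeWeights.standard Γ).vertexWeight
        (graphMetric Γ) ∧
      ∀ (x₀ : G) (μ : ℝ),
        volumeGrowth (EdgeWeights.standard Γ).vertexWeight (graphMetric Γ) x₀ = (μ : EReal) →
        lambdaEss (EdgeWeights.standard Γ) (EdgeWeights.standard Γ).vertexWeight
            ((EdgeWeights.standard Γ).vertexWeight_pos hΓ) ≤
          ((1 - 2 * Real.exp (μ / 2) / (1 + Real.exp μ) : ℝ) : EReal)) ∧
    -- equality on regular trees
    (∀ k : ℕ, Γ.IsTree → Γ.IsRegularOfDegree k → ∀ x₀ : G,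
      -- normalized Laplacian and graph metric, `m = M = 1`
      (∃ μ : ℝ,
        volumeGrowth (EdgeWeights.standard Γ).vertexWeight (graphMetric Γ) x₀ = (μ : EReal) ∧
        lambdaEss (EdgeWeights.standard Γ) (EdgeWeights.standard Γ).vertexWeight
            ((EdgeWeights.standard Γ).vertexWeight_pos hΓ) =
          (growthBound 1 1 μ : EReal)) ∧
      -- unnormalized Laplacian and scaled graph metric, `m = M = 1 / √k`
      (InfiniteMassOnInfiniteConnected Γ (fun _ => 1) ∧
        IsAdaptedMetric (EdgeWeights.standard Γ) (fun _ => 1)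
          (fun x y => 1 / √(k : ℝ) * graphMetric Γ x y) ∧
        ∃ μ : ℝ,
          volumeGrowth (fun _ => 1) (fun x y => 1 / √(k : ℝ) * graphMetric Γ x y) x₀ =
            (μ : EReal) ∧
          lambdaEss (EdgeWeights.standard Γ) (fun _ => 1) (fun _ => one_pos) =
            (growthBound (1 / √(k : ℝ)) (1 / √(k : ℝ)) μ : EReal))) := by
  have hdeg : ∀ x, 1 ≤ (EdgeWeights.standard Γ).vertexWeight x := by
    intro x
    have := (EdgeWeights.standard Γ).vertexWeight_pos hΓ x
    rw [vertexWeight_standard] at this ⊢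
    exact_mod_cast this
  have hmass := infiniteMass_of_le Γ one_pos hdeg
  have hadapt : IsAdaptedMetric (EdgeWeights.standard Γ) (EdgeWeights.standard Γ).vertexWeight
      (graphMetric Γ) := by
    have := isAdaptedMetric_const_mul_graphMetric hΓ
      ((EdgeWeights.standard Γ).vertexWeight_pos hΓ) one_pos
      fun x => by rw [vertexWeight_standard]; simp
    simpa only [one_mul] using this
  refine ⟨fun w θ hθ hinf ρ hρ m M hm _ hmM x₀ => ⟨fun μ hμ => ?_, fun _ => ?_⟩,
    ⟨hmass, hadapt, fun x₀ μ hμ => ?_⟩, fun k hT hreg x₀ => ?_⟩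
  · exact lambdaEss_le_growthBound hθ (hinf.not_summable hΓ) hρ hm hmM x₀ hμ
  · exact lambdaEss_le_of_vertexWeight_le hθ (hρ.vertexWeight_le hθ hm fun x y h => (hmM x y h).1)
  · rw [← growthBound_one_one]
    exact lambdaEss_le_growthBound _ (hmass.not_summable hΓ) hadapt one_pos
      (fun x y h => by rw [graphMetric_eq_one h]; exact ⟨le_rfl, le_rfl⟩) x₀ hμ
  · have hk := two_le_of_isRegularOfDegree hΓ hreg
    have hk0 : (0 : ℝ) < k := by exact_mod_cast (by omega : 0 < k)
    have hs : 0 < 1 / √(k : ℝ) := one_div_pos.2 (Real.sqrt_pos.2 hk0)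
    have hks : (k : ℝ) * (1 / √(k : ℝ)) ^ 2 = 1 := by
      rw [div_pow, Real.sq_sqrt hk0.le]
      field_simp
    refine ⟨?_, infiniteMass_of_le Γ one_pos fun _ => le_rfl,
      isAdaptedMetric_const_mul_graphMetric hΓ (fun _ => one_pos) hs fun x => ?_, ?_⟩
    · have := exists_volumeGrowth_eq_and_lambdaEss_eq hT hreg
        ((EdgeWeights.standard Γ).vertexWeight_pos hΓ) hk0 one_pos
        (vertexWeight_standard_of_isRegular hreg) (by simp) x₀
      simpa only [one_mul] using this
    · rw [hreg x, hks]
    · exact exists_volumeGrowth_eq_and_lambdaEss_eq hT hreg (fun _ => one_pos) one_pos hs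
        (fun _ => rfl) hks x₀
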